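/- A conic is a smooth plane conic in $\mathbb{P}^3=\mathbb{CP}^3$. Let $C_1,C_2$ be conics spanning different planes. A stationary bisecant is a line spanned by points $p\in C_1$, $q\in C_2$, $p\neq q$, such that the tangent lines $T_pC_1$ and $T_qC_2$ meet. The edge curve $E(C_1,C_2)\subset C_1\times C_2$ is the Zariski closure of the set of pairs $(p,q)$ that span a stationary bisecant. A curve has $j$-invariant $J$ if it is isomorphic to an elliptic curve with $j$-invariant $J$. Theorem. (1) For every conic $C_1$ and every $J\in\mathbb{C}$, there is a conic $C_2$, spanning a different plane, such that the edge curve $E(C_1,C_2)$ is a smooth curve of genus one with $j$-invariant $J$. (2) The branch points can be prescribed: for every conic $C_1$ and every set $S$ of four distinct points of $C_1$ there is a conic $C_2$, spanning a different plane, such that the edge curve is smooth of genus one, the projection $E(C_1,C_2)\to C_1$ is a double cover whose set of branch points is $S$, and the $j$-invariant of $E(C_1,C_2)$ is $2^8(\lambda^2-\lambda+1)^3/(\lambda^2(\lambda-1)^2)$, where $S=\{0,1,\lambda,\infty\}$ in a suitable coordinate on $C_1\cong\mathbb{P}^1$. (3) Suppose that $C_1$ and the set $S$ of four distinct points of $C_1$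 are real (that is, $C_1$ is defined over $\mathbb{R}$ and $S$ is stable under complex conjugation). Then $C_2$ in (2) may be taken to be a circle, in the following sense. For a partition of $S$ into two pairs, let $p$ be the point where the tangents to $C_1$ at the points of the first pair meet, and $q$ the corresponding point for the second pair. There is a partition for which $\{p,q\}$ is stable under complex conjugation, and then some affine chart defined over $\mathbb{R}$ contains both $p$ and $q$. For every such partition and for every choice of a Euclidean $\mathbb{R}^3$ in $\mathbb{P}^3$ (real homogeneous coordinates $[y_0:y_1:y_2:y_3]$ with $\mathbb{R}^3=\{y_0\neq 0\}$ and Cartesian coordinates $y_i/y_0$) such that $p$ and $q$ are not on the plane $y_0=0$, there is a circle in this $\mathbb{R}^3$ whose complexification $C_2$ contains $p$ and $q$ and has all the properties in (2). -/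

import Mathlib

open scoped LinearAlgebra.Projectivization Matrix

namespace TwoConics

/-- Complex projective space of dimension three. -/
abbrev P3 : Type := ℙ ℂ (Fin 4 → ℂ)

/-- The complex projective plane. -/
abbrev P2 : Type := ℙ ℂ (Fin 3 → ℂ)

/-! ### Smooth conics in projective three-space -/

/-- A smooth conic in `ℙ³` over `K`: a plane `plane ⬝ᵥ x = 0` together with a quadratic form
`x ⬝ᵥ quad *ᵥ x` (with `quad` symmetric) whose restriction to the plane is nondegenerate. -/
structure Conic (K : Type) [Field K] where
  /-- coefficients of the linear form that cuts out the plane of the conic -/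
  plane : Fin 4 → K
  /-- symmetric matrix of the quadratic form -/
  quad : Matrix (Fin 4) (Fin 4) K
  plane_ne_zero : plane ≠ 0
  isSymm : quad.IsSymm
  smooth : ∀ x : Fin 4 → K, plane ⬝ᵥ x = 0 →
    (∀ y : Fin 4 → K, plane ⬝ᵥ y = 0 → x ⬝ᵥ (quad *ᵥ y) = 0) → x = 0

namespace Conic

/-- The plane spanned by the conic, as a linear subspace of `ℂ⁴`. -/
def span (C : Conic ℂ) : Submodule ℂ (Fin 4 → ℂ) where
  carrier := {y | C.plane ⬝ᵥ y = 0}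
  zero_mem' := by simp
  add_mem' := by
    intro a b ha hb
    change C.plane ⬝ᵥ a = 0 at ha
    change C.plane ⬝ᵥ b = 0 at hb
    change C.plane ⬝ᵥ (a + b) = 0
    rw [dotProduct_add, ha, hb, add_zero]
  smul_mem' := by
    intro c a ha
    change C.plane ⬝ᵥ a = 0 at ha
    change C.plane ⬝ᵥ (c • a) = 0
    rw [dotProduct_smul, ha, smul_zero]

/-- The set of complex points of the conic. -/
def points (C : Conic ℂ) : Set P3 :=
  {p | C.plane ⬝ᵥ p.rep = 0 ∧ p.rep ⬝ᵥ (C.quad *ᵥ p.rep) = 0}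

/-- The tangent line to the conic at its point `p`, as a linear subspace of `ℂ⁴`. -/
def tangent (C : Conic ℂ) (p : P3) : Submodule ℂ (Fin 4 → ℂ) where
  carrier := {y | C.plane ⬝ᵥ y = 0 ∧ p.rep ⬝ᵥ (C.quad *ᵥ y) = 0}
  zero_mem' := by simp
  add_mem' := by
    rintro a b ⟨ha, ha'⟩ ⟨hb, hb'⟩
    refine ⟨?_, ?_⟩
    · rw [dotProduct_add, ha, hb, add_zero]
    · rw [Matrix.mulVec_add, dotProduct_add, ha', hb', add_zero]
  smul_mem' := by
    rintro c a ⟨ha, ha'⟩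
    refine ⟨?_, ?_⟩
    · rw [dotProduct_smul, ha, smul_zero]
    · rw [Matrix.mulVec_smul, dotProduct_smul, ha', smul_zero]

theorem smooth_complexify (C : Conic ℝ) (x : Fin 4 → ℂ)
    (hx : (fun i => (C.plane i : ℂ)) ⬝ᵥ x = 0)
    (h : ∀ y : Fin 4 → ℂ, (fun i => (C.plane i : ℂ)) ⬝ᵥ y = 0 →
      x ⬝ᵥ ((C.quad.map Complex.ofReal) *ᵥ y) = 0) : x = 0 := by
  have key : ∀ y : Fin 4 → ℝ, C.plane ⬝ᵥ y = 0 →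
      x ⬝ᵥ (fun i => (((C.quad *ᵥ y) i : ℝ) : ℂ)) = 0 := by
    intro y hy
    have h1 := h (fun i => (y i : ℂ)) (by
      have := congrArg Complex.ofReal hy
      simpa [dotProduct] using this)
    convert h1 using 2
    funext i
    simp [Matrix.mulVec, dotProduct]
  have hre : (fun i => (x i).re) = 0 := by
    refine C.smooth _ ?_ ?_
    · have := congrArg Complex.re hx
      simpa [dotProduct] using this
    · intro y hy
      have := congrArg Complex.re (key y hy)
      simpa [dotProduct] using this
  have him : (fun i => (x i).im) = 0 := by
    refine C.smooth _ ?_ ?_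
    · have := congrArg Complex.im hx
      simpa [dotProduct] using this
    · intro y hy
      have := congrArg Complex.im (key y hy)
      simpa [dotProduct] using this
  funext i
  exact Complex.ext (congrFun hre i) (congrFun him i)

/-- The complex conic given by the equations of a real conic. -/
def complexify (C : Conic ℝ) : Conic ℂ where
  plane := fun i => (C.plane i : ℂ)
  quad := C.quad.map Complex.ofReal
  plane_ne_zero := by
    intro h
    apply C.plane_ne_zero
    funext i
    have := congrFun h i
    simpa using this
  isSymm := C.isSymm.map _
  smooth := C.smooth_complexify

end Conic

/-! ### The edge curve -/

/-- A polynomial in two groups of four variables that is bihomogeneous of bidegree `(d, e)`. -/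
def IsBihomogeneous (F : MvPolynomial (Fin 4 ⊕ Fin 4) ℂ) (d e : ℕ) : Prop :=
  MvPolynomial.IsWeightedHomogeneous (Sum.elim (fun _ => 1) (fun _ => 0) : Fin 4 ⊕ Fin 4 → ℕ) F d ∧
  MvPolynomial.IsWeightedHomogeneous (Sum.elim (fun _ => 0) (fun _ => 1) : Fin 4 ⊕ Fin 4 → ℕ) F e

/-- The value of `F` at the chosen representatives of a point of `ℙ³ × ℙ³`. -/
noncomputable def evalBi (x : P3 × P3) (F : MvPolynomial (Fin 4 ⊕ Fin 4) ℂ) : ℂ :=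
  MvPolynomial.eval (Sum.elim x.1.rep x.2.rep) F

/-- Zariski closure in `ℙ³ × ℙ³`. -/
def zariskiClosure (X : Set (P3 × P3)) : Set (P3 × P3) :=
  {x | ∀ (F : MvPolynomial (Fin 4 ⊕ Fin 4) ℂ) (d e : ℕ), IsBihomogeneous F d e →
    (∀ y ∈ X, evalBi y F = 0) → evalBi x F = 0}

/-- The pairs of distinct points `p ∈ C₁`, `q ∈ C₂` whose join is a stationary bisecant, that is,
whose tangent lines meet. -/
def stationaryPairs (C₁ C₂ : Conic ℂ) : Set (P3 × P3) :=
  {x | x.1 ∈ C₁.points ∧ x.2 ∈ C₂.points ∧ x.1 ≠ x.2 ∧ C₁.tangent x.1 ⊓ C₂.tangent x.2 ≠ ⊥}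

/-- The edge curve of two conics. -/
def edgeCurve (C₁ C₂ : Conic ℂ) : Set (P3 × P3) :=
  zariskiClosure (stationaryPairs C₁ C₂)

/-! ### Regular maps, isomorphisms and the j-invariant -/

/-- `f` is a regular map on `X ⊆ ℙ³ × ℙ³`: near every point of `X` it is given by bihomogeneous
polynomials of the same bidegree. -/
def IsRegularToP2 (X : Set (P3 × P3)) (f : P3 × P3 → P2) : Prop :=
  ∀ x ∈ X, ∃ (d e : ℕ) (F : Fin 3 → MvPolynomial (Fin 4 ⊕ Fin 4) ℂ),
    (∀ i, IsBihomogeneous (F i) d e) ∧ (fun i => evalBi x (F i)) ≠ 0 ∧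
    ∀ y ∈ X, ∀ hy : (fun i => evalBi y (F i)) ≠ 0,
      f y = Projectivization.mk ℂ (fun i => evalBi y (F i)) hy

/-- `g` is a regular map on `Y ⊆ ℙ²`: near every point of `Y` it is given by homogeneous
polynomials of the same degree. -/
def IsRegularToP3 (Y : Set P2) (g : P2 → P3) : Prop :=
  ∀ x ∈ Y, ∃ (d : ℕ) (G : Fin 4 → MvPolynomial (Fin 3) ℂ),
    (∀ i, (G i).IsHomogeneous d) ∧ (fun i => MvPolynomial.eval x.rep (G i)) ≠ 0 ∧
    ∀ y ∈ Y, ∀ hy : (fun i => MvPolynomial.eval y.rep (G i)) ≠ 0,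
      g y = Projectivization.mk ℂ (fun i => MvPolynomial.eval y.rep (G i)) hy

/-- Isomorphism of projective varieties `X ⊆ ℙ³ × ℙ³` and `Y ⊆ ℙ²`: mutually inverse regular
maps. -/
def AreIsomorphic (X : Set (P3 × P3)) (Y : Set P2) : Prop :=
  ∃ (f : P3 × P3 → P2) (g : P2 → P3 × P3),
    Set.MapsTo f X Y ∧ Set.MapsTo g Y X ∧ Set.LeftInvOn g f X ∧ Set.RightInvOn g f Y ∧
    IsRegularToP2 X f ∧
    IsRegularToP3 Y (fun y => (g y).1) ∧ IsRegularToP3 Y (fun y => (g y).2)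

/-- The projective plane cubic defined by a Weierstrass equation. -/
def weierstrassPoints (W : WeierstrassCurve ℂ) : Set P2 :=
  {p | W.toProjective.Equation p.rep}

/-- `X` is a smooth curve of genus one with j-invariant `J`: it is isomorphic to an elliptic curve
in Weierstrass form with j-invariant `J`. -/
def HasJInvariant (X : Set (P3 × P3)) (J : ℂ) : Prop :=
  ∃ (W : WeierstrassCurve ℂ) (_ : W.IsElliptic), W.j = J ∧ AreIsomorphic X (weierstrassPoints W)

/-! ### Branch points -/

/-- The projection of `E` to the first factor is a double cover of `C` whose set of branch points
is `S`: one point of `E` lies over each point of `S` and two points lie over every other point of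
`C`. -/
def IsDoubleCoverBranchedOver (E : Set (P3 × P3)) (C : Conic ℂ) (S : Set P3) : Prop :=
  ∀ p ∈ C.points,
    (p ∈ S → {q | (p, q) ∈ E}.ncard = 1) ∧ (p ∉ S → {q | (p, q) ∈ E}.ncard = 2)

/-- The quadruple of binary quadratic forms `M *ᵥ ![s ^ 2, s * t, t ^ 2]` parametrizes the
conic `C`. -/
def IsParametrization (C : Conic ℂ) (M : Matrix (Fin 4) (Fin 3) ℂ) : Prop :=
  Function.Injective M.mulVec ∧
  ∀ s t : ℂ, C.plane ⬝ᵥ (M *ᵥ ![s ^ 2, s * t, t ^ 2]) = 0 ∧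
    (M *ᵥ ![s ^ 2, s * t, t ^ 2]) ⬝ᵥ (C.quad *ᵥ (M *ᵥ ![s ^ 2, s * t, t ^ 2])) = 0

/-- In a suitable coordinate `s / t` on `C ≅ ℙ¹`, the points of `S` are `0, 1, l, ∞`. -/
def HasCoordinates (C : Conic ℂ) (S : Set P3) (l : ℂ) : Prop :=
  ∃ (M : Matrix (Fin 4) (Fin 3) ℂ) (a b c d : P3), IsParametrization C M ∧ S = {a, b, c, d} ∧
    M *ᵥ ![0, 0, 1] ∈ a.submodule ∧ M *ᵥ ![1, 1, 1] ∈ b.submodule ∧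
    M *ᵥ ![l ^ 2, l, 1] ∈ c.submodule ∧ M *ᵥ ![1, 0, 0] ∈ d.submodule

/-- `C₁` and `C₂` span different planes, their edge curve is a smooth curve of genus one, the
projection of the edge curve to `C₁` has the set of branch points `S`, and the j-invariant of the
edge curve is the one given by these branch points. -/
def EdgeCurveBranchedOver (C₁ C₂ : Conic ℂ) (S : Set P3) : Prop :=
  C₁.span ≠ C₂.span ∧ IsDoubleCoverBranchedOver (edgeCurve C₁ C₂) C₁ S ∧
  ∃ l : ℂ, l ≠ 0 ∧ l ≠ 1 ∧ HasCoordinates C₁ S l ∧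
    HasJInvariant (edgeCurve C₁ C₂)
      (2 ^ 8 * (l ^ 2 - l + 1) ^ 3 / (l ^ 2 * (l - 1) ^ 2))

/-! ### Reality and circles -/

/-- Complex conjugation on `ℙ³`. -/
noncomputable def conj (p : P3) : P3 :=
  Projectivization.mk ℂ (star p.rep) (star_ne_zero.2 p.rep_nonzero)

/-- A set of points is real when it is stable under complex conjugation. -/
def IsRealSet (S : Set P3) : Prop := conj '' S = S

/-- The homogeneous coordinates of `p` in the real coordinate system `g`. The corresponding
Euclidean space `ℝ³` consists of the real points with nonzero `0`-th coordinate `y₀`, with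
Cartesian coordinates `y₁ / y₀, y₂ / y₀, y₃ / y₀`. -/
noncomputable def coords (g : GL (Fin 4) ℝ) (p : P3) : Fin 4 → ℂ :=
  ((g : Matrix (Fin 4) (Fin 4) ℝ).map Complex.ofReal) *ᵥ p.rep

/-- `C` is the complexification of a circle in the Euclidean space `ℝ³` given by `g`, with
center `c`, radius `r`, and lying in the plane through `c` with normal vector `n`. -/
def IsCircle (g : GL (Fin 4) ℝ) (C : Conic ℂ) : Prop :=
  ∃ (n c : Fin 3 → ℝ) (r : ℝ), n ≠ 0 ∧ 0 < r ∧ ∀ p : P3, p ∈ C.points ↔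
    (∑ i, (n i : ℂ) * (coords g p i.succ - c i * coords g p 0) = 0 ∧
      ∑ i, (coords g p i.succ - c i * coords g p 0) ^ 2 = (r : ℂ) ^ 2 * coords g p 0 ^ 2)

/-- For some partition of `S` into two pairs, the tangents to `C` at the points of one pair meet
in `p` and the tangents at the points of the other pair meet in `q`. -/
def IsPairOfPoles (C : Conic ℂ) (S : Set P3) (p q : P3) : Prop :=
  ∃ a b c d : P3, S = {a, b, c, d} ∧ p.rep ∈ C.tangent a ∧ p.rep ∈ C.tangent b ∧
    q.rep ∈ C.tangent c ∧ q.rep ∈ C.tangent d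

end TwoConics

namespace TwoConics

/-! ### Points of projective spaces -/

/-! Let `L` be the line common to the planes of the two conics. A tangent of `C₁` and a tangent of
`C₂` can only meet on `L`. Sending a point of a conic to the intersection of its tangent with `L`
gives a double cover of `L`, and the edge curve is the fibre product of these two covers. The cover
`C₂ → L` is branched at the two points of `C₂ ∩ L`. Hence the edge curve is branched over those
points of `C₁` whose tangents pass through `C₂ ∩ L`.

So four points of `C₁` are prescribed as branch points by splitting them into two pairs, taking the
poles `p`, `q` of the pairs, and choosing any conic through `p` and `q` in another plane. In
parameters in which the pairs are `{0, l}` and `{1, ∞}`, the poles are `(0, l, 2)` and `(2, 1, 0)`,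
and the fibre product is `s (s - l t) σ² = (s - t) t τ²` (`Config.stationaryPairs_iff`). Neither
pole lies on `C₁`, so the conics are disjoint. The set of stationary pairs is already closed,
because it is cut out on `C₁ × C₂` by one form of bidegree `(1, 1)` (`Config.mem_edgeCurve_iff`).

With `x = s / t` and `y = (x - 1) τ / σ` the equation becomes `y² = x (x - 1) (x - l)`.
`Config.areIsomorphic` extends this birational map to an isomorphism through a closed graph with
explicit charts. The j-invariant of the Legendre curve takes every complex value, which gives (1);
(2) follows from the freedom in `l` and in the position of the four points.

For (3), an involution of a set of four points preserves both pairs of some partition, so real poles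
exist. If `{p, q}` is real, then `p` and `q` are `u ± ε v` with `u`, `v` real and `ε² = ±1`. A
circle through them is found in a plane that contains the direction `v` and is perpendicular to the
plane of `C₁`, with its center far enough from `u` to make the squared radius positive
(`exists_circle_through`). -/

theorem mk_eq_of_mem_submodule {V : Type*} [AddCommGroup V] [Module ℂ V] {p : ℙ ℂ V} {v : V}
    (hv : v ≠ 0) (h : v ∈ p.submodule) : Projectivization.mk ℂ v hv = p := by
  rw [Projectivization.submodule_eq, Submodule.mem_span_singleton] at h
  obtain ⟨a, ha⟩ := h
  conv_rhs => rw [← p.mk_rep]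
  exact (Projectivization.mk_eq_mk_iff' _ _ _ _ _).2 ⟨a, ha⟩

theorem eq_of_mem_submodule {V : Type*} [AddCommGroup V] [Module ℂ V] {p q : ℙ ℂ V} {v : V}
    (hv : v ≠ 0) (hp : v ∈ p.submodule) (hq : v ∈ q.submodule) : p = q :=
  (mk_eq_of_mem_submodule hv hp).symm.trans (mk_eq_of_mem_submodule hv hq)

theorem mem_submodule_mk {V : Type*} [AddCommGroup V] [Module ℂ V] {v : V} (hv : v ≠ 0) :
    v ∈ (Projectivization.mk ℂ v hv).submodule := by
  rw [Projectivization.submodule_mk]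
  exact Submodule.mem_span_singleton_self v

theorem rep_mem_submodule {V : Type*} [AddCommGroup V] [Module ℂ V] (p : ℙ ℂ V) :
    p.rep ∈ p.submodule := by
  rw [Projectivization.submodule_eq]
  exact Submodule.mem_span_singleton_self _

theorem exists_rep_eq_smul {V : Type*} [AddCommGroup V] [Module ℂ V] {p : ℙ ℂ V} {v : V}
    (hv : v ≠ 0) (h : v ∈ p.submodule) : ∃ c : ℂ, c ≠ 0 ∧ p.rep = c • v := by
  rw [Projectivization.submodule_eq, Submodule.mem_span_singleton] at h
  obtain ⟨a, ha⟩ := h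
  have ha0 : a ≠ 0 := by
    rintro rfl
    exact hv (by rw [← ha, zero_smul])
  exact ⟨a⁻¹, inv_ne_zero ha0, by rw [← ha, inv_smul_smul₀ ha0]⟩

/-! ### The bilinear form of a conic -/

theorem finrank_ker_dotProduct {φ : Fin 4 → ℂ} (hφ : φ ≠ 0) :
    Module.finrank ℂ (LinearMap.ker (dotProductBilin ℂ ℂ φ)) = 3 := by
  have hf : (dotProductBilin ℂ ℂ φ : Module.Dual ℂ (Fin 4 → ℂ)) ≠ 0 := by
    intro h
    apply hφ
    funext i
    have := LinearMap.congr_fun h (Pi.single i 1)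
    simpa using this
  have h1 := Module.Dual.finrank_ker_add_one_of_ne_zero hf
  simp at h1
  exact h1

namespace Conic

variable {K : Type} [Field K]

/-- The polar form of the quadratic form of a conic. -/
def polar (C : Conic K) (x y : Fin 4 → K) : K := x ⬝ᵥ (C.quad *ᵥ y)

theorem polar_comm (C : Conic K) (x y : Fin 4 → K) : C.polar x y = C.polar y x := by
  unfold polar
  rw [Matrix.dotProduct_mulVec, ← Matrix.mulVec_transpose, C.isSymm.eq, dotProduct_comm]

theorem polar_add_right (C : Conic K) (x y z : Fin 4 → K) :
    C.polar x (y + z) = C.polar x y + C.polar x z := by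
  simp [polar, Matrix.mulVec_add]

theorem polar_add_left (C : Conic K) (x y z : Fin 4 → K) :
    C.polar (x + y) z = C.polar x z + C.polar y z := by
  simp [polar]

theorem polar_smul_right (C : Conic K) (a : K) (x y : Fin 4 → K) :
    C.polar x (a • y) = a * C.polar x y := by
  simp [polar, Matrix.mulVec_smul]

theorem polar_smul_left (C : Conic K) (a : K) (x y : Fin 4 → K) :
    C.polar (a • x) y = a * C.polar x y := by
  simp [polar]

theorem mem_span (C : Conic ℂ) (x : Fin 4 → ℂ) : x ∈ C.span ↔ C.plane ⬝ᵥ x = 0 := Iff.rfl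

theorem finrank_span (C : Conic ℂ) : Module.finrank ℂ C.span = 3 :=
  finrank_ker_dotProduct C.plane_ne_zero

theorem eq_zero_of_polar (C : Conic K) (x : Fin 4 → K) (hx : C.plane ⬝ᵥ x = 0)
    (h : ∀ y, C.plane ⬝ᵥ y = 0 → C.polar x y = 0) : x = 0 :=
  C.smooth x hx h

end Conic

/-! ### Good parametrizations -/

/-- The point of the standard conic `x z = y ^ 2` with parameter `s : t`. -/
def veronese (s t : ℂ) : Fin 3 → ℂ := ![s ^ 2, s * t, t ^ 2]

/-- `M` identifies the standard conic `x z = y ^ 2` with `C`, where `k` is the factor by which the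
two quadratic forms differ. -/
structure IsGood (C : Conic ℂ) (M : Matrix (Fin 4) (Fin 3) ℂ) (k : ℂ) : Prop where
  ne_zero : k ≠ 0
  inj : Function.Injective M.mulVec
  range : ∀ x, C.plane ⬝ᵥ x = 0 ↔ ∃ a, M *ᵥ a = x
  form : ∀ a b, C.polar (M *ᵥ a) (M *ᵥ b) = k * (a 0 * b 2 + a 2 * b 0 - 2 * a 1 * b 1)

/-- The matrix with columns `P`, `R`, `Q`. -/
def columns (P R Q : Fin 4 → ℂ) : Matrix (Fin 4) (Fin 3) ℂ := Matrix.of fun i => ![P i, R i, Q i]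

theorem columns_mulVec (P R Q : Fin 4 → ℂ) (a : Fin 3 → ℂ) :
    columns P R Q *ᵥ a = a 0 • P + a 1 • R + a 2 • Q := by
  funext i
  simp [columns, Matrix.mulVec, dotProduct, Fin.sum_univ_three]
  ring

theorem mulVec_injective_of {M : Matrix (Fin 4) (Fin 3) ℂ} (h : ∀ a, M *ᵥ a = 0 → a = 0) :
    Function.Injective M.mulVec := by
  intro a b hab
  have : M *ᵥ (a - b) = 0 := by rw [Matrix.mulVec_sub]; exact sub_eq_zero.2 hab
  exact sub_eq_zero.1 (h _ this)

/-- An injective `M` has an image of dimension three, which must be the whole plane `φ = 0` as soon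
as it lies in it. -/
theorem exists_of_injective {φ : Fin 4 → ℂ} (hφ : φ ≠ 0) {M : Matrix (Fin 4) (Fin 3) ℂ}
    (hM : Function.Injective M.mulVec) (h : ∀ a, φ ⬝ᵥ (M *ᵥ a) = 0) (x : Fin 4 → ℂ)
    (hx : φ ⬝ᵥ x = 0) : ∃ a, M *ᵥ a = x := by
  have h1 : LinearMap.range M.mulVecLin ≤ LinearMap.ker (dotProductBilin ℂ ℂ φ) := by
    rintro _ ⟨a, rfl⟩
    exact h a
  have h2 : Module.finrank ℂ (LinearMap.range M.mulVecLin) = 3 := by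
    rw [LinearMap.finrank_range_of_inj hM]
    simp
  have h3 := Submodule.eq_of_le_of_finrank_eq h1 (h2.trans (finrank_ker_dotProduct hφ).symm)
  have h4 : x ∈ LinearMap.range M.mulVecLin := by
    rw [h3]; exact hx
  exact h4

theorem exists_mem_span_not_mem (C : Conic ℂ) (P Q : Fin 4 → ℂ) :
    ∃ R, C.plane ⬝ᵥ R = 0 ∧ ∀ a b : ℂ, R ≠ a • P + b • Q := by
  by_contra! hcon
  have h1 : C.span ≤ Submodule.span ℂ {P, Q} := by
    intro x hx
    obtain ⟨a, b, h⟩ := hcon x hx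
    rw [Submodule.mem_span_pair]
    exact ⟨a, b, h.symm⟩
  have h2 := Submodule.finrank_mono h1
  rw [C.finrank_span] at h2
  have h3 := finrank_span_finset_le_card (R := ℂ) ({P, Q} : Finset (Fin 4 → ℂ))
  have h4 := Finset.card_le_two (a := P) (b := Q)
  rw [Finset.coe_pair, Set.finrank] at h3
  omega

/-- Two distinct points of a smooth conic form a hyperbolic pair for its quadratic form. A suitably
scaled vector of the plane orthogonal to both completes them to a basis in which the form is a
multiple of `x z - y²`. Prescribing `P` and `Q` as first and last basis vectors gives them the
parameters `∞` and `0`. -/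
theorem exists_isGood (C : Conic ℂ) (P Q : Fin 4 → ℂ) (hP : C.plane ⬝ᵥ P = 0)
    (hQ : C.plane ⬝ᵥ Q = 0) (hPP : C.polar P P = 0) (hQQ : C.polar Q Q = 0)
    (hind : ∀ a b : ℂ, a • P + b • Q = 0 → a = 0 ∧ b = 0) :
    ∃ M k, IsGood C M k ∧ M *ᵥ ![1, 0, 0] = P ∧ M *ᵥ ![0, 0, 1] = Q := by
  obtain ⟨R₀, hR₀, hR₀'⟩ := exists_mem_span_not_mem C P Q
  have hinj : ∀ R : Fin 4 → ℂ, (∀ a b : ℂ, R ≠ a • P + b • Q) →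
      Function.Injective (columns P R Q).mulVec := by
    intro R hR
    apply mulVec_injective_of
    intro a ha
    rw [columns_mulVec] at ha
    have h1 : a 1 = 0 := by
      by_contra h1
      apply hR (-(a 1)⁻¹ * a 0) (-(a 1)⁻¹ * a 2)
      have : (a 1)⁻¹ • (a 0 • P + a 1 • R + a 2 • Q) = 0 := by rw [ha, smul_zero]
      rw [smul_add, smul_add, smul_smul, smul_smul, smul_smul, inv_mul_cancel₀ h1, one_smul] at this
      rw [neg_mul, neg_mul, neg_smul, neg_smul]
      linear_combination this
    rw [h1, zero_smul, add_zero] at ha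
    obtain ⟨h0, h2⟩ := hind _ _ ha
    funext i
    fin_cases i <;> assumption
  have hpl : ∀ R : Fin 4 → ℂ, C.plane ⬝ᵥ R = 0 → ∀ a, C.plane ⬝ᵥ (columns P R Q *ᵥ a) = 0 := by
    intro R hR a
    rw [columns_mulVec]
    simp [hP, hQ, hR]
  have hspan : ∀ x, C.plane ⬝ᵥ x = 0 → ∃ a b c : ℂ, x = a • P + b • R₀ + c • Q := by
    intro x hx
    obtain ⟨a, rfl⟩ := exists_of_injective C.plane_ne_zero (hinj _ hR₀') (hpl _ hR₀) x hx
    exact ⟨_, _, _, columns_mulVec _ _ _ _⟩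
  have hP0 : P ≠ 0 := by
    rintro rfl
    have := (hind 1 0 (by simp)).1
    exact one_ne_zero this
  have hb : C.polar P Q ≠ 0 := by
    intro hb
    -- If `P` and `Q` were orthogonal, this combination would be orthogonal to `P`, `Q` and `R₀`,
    -- hence zero. Its coefficients then vanish, and `P` itself lies in the radical.
    have key : C.polar R₀ Q • P + (-C.polar R₀ P) • Q = 0 := by
      apply C.eq_zero_of_polar
      · simp [hP, hQ]
      · intro y hy
        obtain ⟨a, b, c, rfl⟩ := hspan y hy
        simp only [C.polar_add_left, C.polar_add_right, C.polar_smul_left, C.polar_smul_right, hPP,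
          hQQ, hb, C.polar_comm Q P, C.polar_comm P R₀, C.polar_comm Q R₀]
        ring
    obtain ⟨h1, h2⟩ := hind _ _ key
    apply hP0
    apply C.eq_zero_of_polar _ hP
    intro y hy
    obtain ⟨a, b, c, rfl⟩ := hspan y hy
    simp only [C.polar_add_right, C.polar_smul_right, hPP, hb, C.polar_comm P R₀]
    linear_combination -b * h2
  -- `R₁` is `R₀` minus its orthogonal projection to the hyperbolic plane of `P` and `Q`.
  obtain ⟨R₁, hR₁def⟩ : ∃ R₁, R₁ = R₀ + (-(C.polar R₀ Q / C.polar P Q)) • P +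
    (-(C.polar R₀ P / C.polar P Q)) • Q := ⟨_, rfl⟩
  have hR₁ : C.plane ⬝ᵥ R₁ = 0 := by simp [hR₁def, hP, hQ, hR₀]
  have hR₁P : C.polar R₁ P = 0 := by
    simp only [hR₁def, C.polar_add_left, C.polar_smul_left, hPP, C.polar_comm Q P]
    field_simp
    ring
  have hR₁Q : C.polar R₁ Q = 0 := by
    simp only [hR₁def, C.polar_add_left, C.polar_smul_left, hQQ]
    field_simp
    ring
  have hR₁ind : ∀ a b : ℂ, R₁ ≠ a • P + b • Q := by
    intro a b h
    apply hR₀' (a + C.polar R₀ Q / C.polar P Q) (b + C.polar R₀ P / C.polar P Q)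
    rw [add_smul, add_smul]
    rw [hR₁def] at h
    rw [neg_smul, neg_smul] at h
    linear_combination h
  have he : C.polar R₁ R₁ ≠ 0 := by
    intro he
    apply hR₁ind 0 0
    rw [zero_smul, zero_smul, add_zero]
    apply C.eq_zero_of_polar _ hR₁
    intro y hy
    obtain ⟨a, rfl⟩ := exists_of_injective C.plane_ne_zero (hinj _ hR₁ind) (hpl _ hR₁) y hy
    rw [columns_mulVec]
    simp only [C.polar_add_right, C.polar_smul_right, hR₁P, hR₁Q, he]
    ring
  -- The scale `m` makes the value of the form at `m • R₁` equal to `-2 * C.polar P Q`, the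
  -- coefficient required by `x z - y²`.
  obtain ⟨m, hm⟩ := IsAlgClosed.exists_pow_nat_eq (-2 * C.polar P Q / C.polar R₁ R₁) two_pos
  have hm0 : m ≠ 0 := by
    rintro rfl
    have : -2 * C.polar P Q / C.polar R₁ R₁ ≠ 0 :=
      div_ne_zero (mul_ne_zero (by norm_num) hb) he
    exact this (by rw [← hm]; norm_num)
  have hind' : ∀ a b : ℂ, m • R₁ ≠ a • P + b • Q := by
    intro a b h
    apply hR₁ind (m⁻¹ * a) (m⁻¹ * b)
    rw [mul_smul, mul_smul, ← smul_add, ← h, inv_smul_smul₀ hm0]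
  have hR : C.plane ⬝ᵥ (m • R₁) = 0 := by simp [hR₁]
  refine ⟨columns P (m • R₁) Q, C.polar P Q, ⟨hb, hinj _ hind', ?_, ?_⟩, ?_, ?_⟩
  · intro x
    refine ⟨exists_of_injective C.plane_ne_zero (hinj _ hind') (hpl _ hR) x, ?_⟩
    rintro ⟨a, rfl⟩
    exact hpl _ hR a
  · intro a b
    rw [columns_mulVec, columns_mulVec]
    have hm' : m ^ 2 * C.polar R₁ R₁ = -2 * C.polar P Q := by
      rw [hm]; field_simp
    simp only [C.polar_add_left, C.polar_add_right, C.polar_smul_left, C.polar_smul_right, hPP,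
      hQQ, hR₁P, hR₁Q, C.polar_comm Q P, C.polar_comm P R₁, C.polar_comm Q R₁]
    linear_combination a 1 * b 1 * hm'
  · simp [columns_mulVec]
  · simp [columns_mulVec]

/-! ### Bihomogeneous polynomials -/

theorem isBihomogeneous_linear {ι : Fin 4 → Fin 4 ⊕ Fin 4} {d e : ℕ} (φ : Fin 4 → ℂ)
    (hι : ∀ i, (Sum.elim (fun _ => 1) (fun _ => 0) : Fin 4 ⊕ Fin 4 → ℕ) (ι i) = d ∧
      (Sum.elim (fun _ => 0) (fun _ => 1) : Fin 4 ⊕ Fin 4 → ℕ) (ι i) = e) :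
    IsBihomogeneous (∑ i, MvPolynomial.C (φ i) * MvPolynomial.X (ι i)) d e := by
  constructor
  · refine MvPolynomial.IsWeightedHomogeneous.sum _ _ _ fun i _ => ?_
    have := MvPolynomial.isWeightedHomogeneous_X ℂ
      (Sum.elim (fun _ => 1) (fun _ => 0) : Fin 4 ⊕ Fin 4 → ℕ) (ι i)
    rw [(hι i).1] at this
    exact this.C_mul _
  · refine MvPolynomial.IsWeightedHomogeneous.sum _ _ _ fun i _ => ?_
    have := MvPolynomial.isWeightedHomogeneous_X ℂ
      (Sum.elim (fun _ => 0) (fun _ => 1) : Fin 4 ⊕ Fin 4 → ℕ) (ι i)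
    rw [(hι i).2] at this
    exact this.C_mul _

/-- The bilinear form with matrix `K` in two groups of variables. -/
noncomputable def bilinearPoly (ι κ : Fin 4 → Fin 4 ⊕ Fin 4) (K : Matrix (Fin 4) (Fin 4) ℂ) :
    MvPolynomial (Fin 4 ⊕ Fin 4) ℂ :=
  ∑ i, ∑ j, MvPolynomial.C (K i j) * (MvPolynomial.X (ι i) * MvPolynomial.X (κ j))

theorem isBihomogeneous_bilinearPoly {ι κ : Fin 4 → Fin 4 ⊕ Fin 4} {d e d' e' : ℕ}
    (K : Matrix (Fin 4) (Fin 4) ℂ)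
    (hι : ∀ i, (Sum.elim (fun _ => 1) (fun _ => 0) : Fin 4 ⊕ Fin 4 → ℕ) (ι i) = d ∧
      (Sum.elim (fun _ => 0) (fun _ => 1) : Fin 4 ⊕ Fin 4 → ℕ) (ι i) = e)
    (hκ : ∀ i, (Sum.elim (fun _ => 1) (fun _ => 0) : Fin 4 ⊕ Fin 4 → ℕ) (κ i) = d' ∧
      (Sum.elim (fun _ => 0) (fun _ => 1) : Fin 4 ⊕ Fin 4 → ℕ) (κ i) = e') :
    IsBihomogeneous (bilinearPoly ι κ K) (d + d') (e + e') := by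
  constructor
  · refine MvPolynomial.IsWeightedHomogeneous.sum _ _ _ fun i _ =>
      MvPolynomial.IsWeightedHomogeneous.sum _ _ _ fun j _ => ?_
    have h1 := MvPolynomial.isWeightedHomogeneous_X ℂ
      (Sum.elim (fun _ => 1) (fun _ => 0) : Fin 4 ⊕ Fin 4 → ℕ) (ι i)
    have h2 := MvPolynomial.isWeightedHomogeneous_X ℂ
      (Sum.elim (fun _ => 1) (fun _ => 0) : Fin 4 ⊕ Fin 4 → ℕ) (κ j)
    rw [(hι i).1] at h1
    rw [(hκ j).1] at h2
    exact (h1.mul h2).C_mul _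
  · refine MvPolynomial.IsWeightedHomogeneous.sum _ _ _ fun i _ =>
      MvPolynomial.IsWeightedHomogeneous.sum _ _ _ fun j _ => ?_
    have h1 := MvPolynomial.isWeightedHomogeneous_X ℂ
      (Sum.elim (fun _ => 0) (fun _ => 1) : Fin 4 ⊕ Fin 4 → ℕ) (ι i)
    have h2 := MvPolynomial.isWeightedHomogeneous_X ℂ
      (Sum.elim (fun _ => 0) (fun _ => 1) : Fin 4 ⊕ Fin 4 → ℕ) (κ j)
    rw [(hι i).2] at h1
    rw [(hκ j).2] at h2
    exact (h1.mul h2).C_mul _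

theorem evalBi_bilinearPoly (x : P3 × P3) (ι κ : Fin 4 → Fin 4 ⊕ Fin 4)
    (K : Matrix (Fin 4) (Fin 4) ℂ) :
    evalBi x (bilinearPoly ι κ K) = (fun i => Sum.elim x.1.rep x.2.rep (ι i)) ⬝ᵥ
      (K *ᵥ fun i => Sum.elim x.1.rep x.2.rep (κ i)) := by
  simp only [evalBi, bilinearPoly, map_sum, map_mul, MvPolynomial.eval_C, MvPolynomial.eval_X,
    dotProduct, Matrix.mulVec, Finset.mul_sum]
  refine Finset.sum_congr rfl fun i _ => Finset.sum_congr rfl fun j _ => ?_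
  ring

theorem evalBi_linear (x : P3 × P3) (ι : Fin 4 → Fin 4 ⊕ Fin 4) (φ : Fin 4 → ℂ) :
    evalBi x (∑ i, MvPolynomial.C (φ i) * MvPolynomial.X (ι i)) =
      φ ⬝ᵥ fun i => Sum.elim x.1.rep x.2.rep (ι i) := by
  simp only [evalBi, map_sum, map_mul, MvPolynomial.eval_C, MvPolynomial.eval_X, dotProduct]

theorem subset_zariskiClosure (X : Set (P3 × P3)) : X ⊆ zariskiClosure X :=
  fun x hx _ _ _ _ h => h x hx

/-! ### The Veronese parametrization -/

theorem veronese_ne_zero {s t : ℂ} (h : s ≠ 0 ∨ t ≠ 0) : veronese s t ≠ 0 := by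
  intro h0
  have h1 := congrFun h0 0
  have h2 := congrFun h0 2
  simp [veronese] at h1 h2
  tauto

theorem exists_eq_veronese {a : Fin 3 → ℂ} (h : a 0 * a 2 = a 1 ^ 2) :
    ∃ s t, a = veronese s t := by
  obtain ⟨s, hs⟩ := IsAlgClosed.exists_pow_nat_eq (a 0) two_pos
  obtain ⟨t, ht⟩ := IsAlgClosed.exists_pow_nat_eq (a 2) two_pos
  have h1 : (s * t) ^ 2 = a 1 ^ 2 := by rw [mul_pow, hs, ht, h]
  rcases sq_eq_sq_iff_eq_or_eq_neg.1 h1 with h2 | h2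
  · refine ⟨s, t, ?_⟩
    funext i
    fin_cases i <;> simp [veronese, hs, ht, h2]
  · refine ⟨s, -t, ?_⟩
    funext i
    fin_cases i <;> simp [veronese, hs, ht, h2]

/-- The square of `s t' - s' t` is the polar form of `x z - y²` at the two Veronese vectors, so it
vanishes when they are proportional. -/
theorem mul_eq_mul_of_veronese {s t s' t' c : ℂ} (h : veronese s t = c • veronese s' t') :
    s * t' = s' * t := by
  have h0 := congrFun h 0
  have h1 := congrFun h 1
  have h2 := congrFun h 2
  simp [veronese] at h0 h1 h2
  have : (s * t' - s' * t) ^ 2 = 0 := by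
    linear_combination t' ^ 2 * h0 - 2 * s' * t' * h1 + s' ^ 2 * h2
  exact sub_eq_zero.1 (pow_eq_zero_iff two_ne_zero |>.1 this)

theorem exists_smul_of_mul_eq_mul {s t s' t' : ℂ} (h : s ≠ 0 ∨ t ≠ 0) (h' : s' ≠ 0 ∨ t' ≠ 0)
    (he : s * t' = s' * t) : ∃ c, c ≠ 0 ∧ s' = c * s ∧ t' = c * t := by
  by_cases hs : s = 0
  · subst hs
    have ht : t ≠ 0 := by simpa using h
    have hs' : s' = 0 := by simpa [ht] using he.symm
    have ht' : t' ≠ 0 := by simpa [hs'] using h'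
    exact ⟨t' / t, div_ne_zero ht' ht, by simp [hs'], by field_simp⟩
  · have hs' : s' ≠ 0 := by
      rintro rfl
      simp [hs] at he
      simp [he] at h'
    refine ⟨s' / s, div_ne_zero hs' hs, by field_simp, ?_⟩
    field_simp
    linear_combination he

theorem veronese_mul (c s t : ℂ) : veronese (c * s) (c * t) = c ^ 2 • veronese s t := by
  funext i
  fin_cases i <;> simp [veronese] <;> ring

theorem exists_leftInverse {M : Matrix (Fin 4) (Fin 3) ℂ} (hM : Function.Injective M.mulVec) :
    ∃ N : Matrix (Fin 3) (Fin 4) ℂ, ∀ a, N *ᵥ (M *ᵥ a) = a := by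
  obtain ⟨f, hf⟩ := LinearMap.exists_leftInverse_of_injective M.mulVecLin
    (LinearMap.ker_eq_bot.2 hM)
  refine ⟨LinearMap.toMatrix' f, fun a => ?_⟩
  rw [LinearMap.toMatrix'_mulVec]
  exact LinearMap.congr_fun hf a

/-- The point `p` has parameter `s : t` in the parametrization `M`. -/
structure HasParam (M : Matrix (Fin 4) (Fin 3) ℂ) (p : P3) (s t : ℂ) : Prop where
  ne : s ≠ 0 ∨ t ≠ 0
  mem : M *ᵥ veronese s t ∈ p.submodule

namespace HasParam

variable {M : Matrix (Fin 4) (Fin 3) ℂ} {p q : P3} {s t s' t' : ℂ}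

theorem of_mul_eq_mul (h : HasParam M p s t) (hne : s' ≠ 0 ∨ t' ≠ 0) (he : s * t' = s' * t) :
    HasParam M p s' t' := by
  obtain ⟨c, hc, rfl, rfl⟩ := exists_smul_of_mul_eq_mul h.ne hne he
  refine ⟨hne, ?_⟩
  rw [veronese_mul, Matrix.mulVec_smul]
  exact Submodule.smul_mem _ _ h.mem

end HasParam

namespace IsGood

variable {C : Conic ℂ} {M : Matrix (Fin 4) (Fin 3) ℂ} {k : ℂ} {p q : P3} {s t s' t' : ℂ}

theorem mulVec_ne_zero (hM : IsGood C M k) {a : Fin 3 → ℂ} (ha : a ≠ 0) : M *ᵥ a ≠ 0 := by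
  intro h
  exact ha (hM.inj (by simpa using h))

theorem veronese_ne_zero (hM : IsGood C M k) (h : s ≠ 0 ∨ t ≠ 0) : M *ᵥ veronese s t ≠ 0 :=
  hM.mulVec_ne_zero (TwoConics.veronese_ne_zero h)

theorem exists_hasParam (hM : IsGood C M k) (h : s ≠ 0 ∨ t ≠ 0) : ∃ p, HasParam M p s t :=
  ⟨_, h, mem_submodule_mk (hM.veronese_ne_zero h)⟩

theorem hasParam_unique (hM : IsGood C M k) (h : HasParam M p s t) (h' : HasParam M p s' t') :
    s * t' = s' * t := by
  obtain ⟨c, hc, hc'⟩ := exists_rep_eq_smul (hM.veronese_ne_zero h.ne) h.mem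
  obtain ⟨d, hd, hd'⟩ := exists_rep_eq_smul (hM.veronese_ne_zero h'.ne) h'.mem
  refine mul_eq_mul_of_veronese (c := c⁻¹ * d) (hM.inj ?_)
  rw [Matrix.mulVec_smul, mul_smul, ← hd', hc', inv_smul_smul₀ hc]

theorem hasParam_eq (hM : IsGood C M k) (h : HasParam M p s t) (h' : HasParam M q s' t')
    (he : s * t' = s' * t) : p = q :=
  eq_of_mem_submodule (hM.veronese_ne_zero h'.ne) (h.of_mul_eq_mul h'.ne he).mem h'.mem

theorem isotropic_iff (hM : IsGood C M k) (a : Fin 3 → ℂ) :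
    C.polar (M *ᵥ a) (M *ᵥ a) = 0 ↔ a 0 * a 2 = a 1 ^ 2 := by
  rw [hM.form, mul_eq_zero, or_iff_right hM.ne_zero]
  constructor <;> intro h
  · linear_combination ((1 : ℂ) / 2) * h
  · linear_combination 2 * h

theorem isotropic_iff' (hM : IsGood C M k) (a : Fin 3 → ℂ) :
    C.polar (M *ᵥ a) (M *ᵥ a) = 0 ↔ ∃ s t, a = veronese s t := by
  rw [hM.isotropic_iff]
  constructor
  · exact exists_eq_veronese
  · rintro ⟨s, t, rfl⟩
    simp [veronese]
    ring

theorem mem_points_iff (hM : IsGood C M k) : p ∈ C.points ↔ ∃ s t, HasParam M p s t := by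
  constructor
  · rintro ⟨h1, h2⟩
    obtain ⟨a, ha⟩ := (hM.range _).1 h1
    rw [← ha] at h2
    obtain ⟨s, t, rfl⟩ := (hM.isotropic_iff' a).1 h2
    refine ⟨s, t, ?_, ?_⟩
    · by_contra! h
      apply p.rep_nonzero
      rw [← ha, h.1, h.2]
      have : veronese 0 0 = 0 := by
        funext i
        fin_cases i <;> simp [veronese]
      rw [this, Matrix.mulVec_zero]
    · rw [ha]
      exact rep_mem_submodule p
  · rintro ⟨s, t, h⟩
    obtain ⟨c, hc, hc'⟩ := exists_rep_eq_smul (hM.veronese_ne_zero h.ne) h.mem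
    refine ⟨?_, ?_⟩
    · rw [hc', dotProduct_smul, (hM.range _).2 ⟨_, rfl⟩, smul_zero]
    · change C.polar _ _ = 0
      rw [hc', C.polar_smul_left, C.polar_smul_right, (hM.isotropic_iff' _).2 ⟨s, t, rfl⟩]
      simp

/-- The tangent is the polar line of the point, so its equation is the polar form of `x z - y²` at
`(s², s t, t²)`. -/
theorem mem_tangent_iff (hM : IsGood C M k) (h : HasParam M p s t) (b : Fin 3 → ℂ) :
    M *ᵥ b ∈ C.tangent p ↔ t ^ 2 * b 0 - 2 * s * t * b 1 + s ^ 2 * b 2 = 0 := by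
  obtain ⟨c, hc, hc'⟩ := exists_rep_eq_smul (hM.veronese_ne_zero h.ne) h.mem
  change (C.plane ⬝ᵥ _ = 0 ∧ C.polar _ _ = 0) ↔ _
  rw [hc', C.polar_smul_left, hM.form, and_iff_right ((hM.range _).2 ⟨b, rfl⟩), mul_eq_zero,
    or_iff_right hc, mul_eq_zero, or_iff_right hM.ne_zero]
  simp only [veronese, Matrix.cons_val_zero, Matrix.cons_val_one, Matrix.cons_val]
  constructor <;> intro h <;> linear_combination h

theorem isParametrization (hM : IsGood C M k) : IsParametrization C M := by
  refine ⟨hM.inj, fun s t => ⟨(hM.range _).2 ⟨_, rfl⟩, ?_⟩⟩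
  exact (hM.isotropic_iff' _).2 ⟨s, t, rfl⟩

end IsGood

/-! ### The equation of the edge curve -/

/-- The conics `C₁` and `C₂` meet the line common to their planes in such a way that the edge curve
is `s (s - l t) σ² = (s - t) t τ²` in the parameters `s : t` and `σ : τ` of the two conics. -/
structure Config (C₁ C₂ : Conic ℂ) (M₁ M₂ : Matrix (Fin 4) (Fin 3) ℂ) (k₁ k₂ l : ℂ) : Prop where
  good₁ : IsGood C₁ M₁ k₁
  good₂ : IsGood C₂ M₂ k₂
  ne_zero : l ≠ 0
  ne_one : l ≠ 1
  eq₀ : M₂ *ᵥ ![1, 0, 0] = M₁ *ᵥ ![0, l, 2]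
  eq₂ : M₂ *ᵥ ![0, 0, 1] = -(M₁ *ᵥ ![2, 1, 0])
  span_ne : C₁.span ≠ C₂.span

/-- The equation of the edge curve in parameters. -/
def EdgeEq (l s t σ τ : ℂ) : Prop := s * (s - l * t) * σ ^ 2 = (s - t) * t * τ ^ 2

namespace Config

variable {C₁ C₂ : Conic ℂ} {M₁ M₂ : Matrix (Fin 4) (Fin 3) ℂ} {k₁ k₂ l : ℂ}

/-- The vectors with middle coordinate zero on the second conic span the line `L` common to the two
planes; this translates its points to the coordinates of the first conic. The sign in `eq₂` is there
to make the edge equation free of signs. -/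
theorem mulVec₂ (h : Config C₁ C₂ M₁ M₂ k₁ k₂ l) (a b : ℂ) :
    M₂ *ᵥ ![a, 0, b] = M₁ *ᵥ ![-2 * b, a * l - b, 2 * a] := by
  have h1 : (![a, 0, b] : Fin 3 → ℂ) = a • ![1, 0, 0] + b • ![0, 0, 1] := by
    funext i
    fin_cases i <;> simp
  have h2 : (![-2 * b, a * l - b, 2 * a] : Fin 3 → ℂ) = a • ![0, l, 2] - b • ![2, 1, 0] := by
    funext i
    fin_cases i <;> simp <;> ring
  rw [h1, h2, Matrix.mulVec_add, Matrix.mulVec_sub, Matrix.mulVec_smul, Matrix.mulVec_smul,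
    Matrix.mulVec_smul, Matrix.mulVec_smul, h.eq₀, h.eq₂, smul_neg, sub_eq_add_neg]

/-- The plane of `C₁` contains the first and last columns of `M₂`. If it also contained the middle
one, the two planes would coincide. -/
theorem plane_iff (h : Config C₁ C₂ M₁ M₂ k₁ k₂ l) (b : Fin 3 → ℂ) :
    C₁.plane ⬝ᵥ (M₂ *ᵥ b) = 0 ↔ b 1 = 0 := by
  have h0 : ∀ a c, C₁.plane ⬝ᵥ (M₂ *ᵥ ![a, 0, c]) = 0 := by
    intro a c
    rw [h.mulVec₂]
    exact (h.good₁.range _).2 ⟨_, rfl⟩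
  have h1 : ∀ b : Fin 3 → ℂ, C₁.plane ⬝ᵥ (M₂ *ᵥ b) = b 1 * C₁.plane ⬝ᵥ (M₂ *ᵥ ![0, 1, 0]) := by
    intro b
    have : b = ![b 0, 0, b 2] + b 1 • ![0, 1, 0] := by
      funext i
      fin_cases i <;> simp
    conv_lhs => rw [this]
    rw [Matrix.mulVec_add, Matrix.mulVec_smul, dotProduct_add, dotProduct_smul, h0, zero_add,
      smul_eq_mul]
  rw [h1, mul_eq_zero, or_iff_left]
  intro h2
  apply h.span_ne
  symm
  apply Submodule.eq_of_le_of_finrank_eq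
  · intro x hx
    obtain ⟨b, rfl⟩ := (h.good₂.range x).1 hx
    change C₁.plane ⬝ᵥ _ = 0
    rw [h1, h2, mul_zero]
  · rw [C₁.finrank_span, C₂.finrank_span]

/-- The tangents meet exactly when they cut `L` in the same point. The tangent of `C₁` gives `b₀ s
(s - l t) + b₂ t (s - t) = 0` and that of `C₂` gives `τ² b₀ + σ² b₂ = 0`; these have a common
nonzero solution if and only if the edge equation holds. -/
theorem stationaryPairs_iff (h : Config C₁ C₂ M₁ M₂ k₁ k₂ l) (x : P3 × P3) :
    x ∈ stationaryPairs C₁ C₂ ↔ ∃ s t σ τ, HasParam M₁ x.1 s t ∧ HasParam M₂ x.2 σ τ ∧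
      EdgeEq l s t σ τ := by
  constructor
  · rintro ⟨h1, h2, -, h3⟩
    obtain ⟨s, t, hst⟩ := h.good₁.mem_points_iff.1 h1
    obtain ⟨σ, τ, hστ⟩ := h.good₂.mem_points_iff.1 h2
    refine ⟨s, t, σ, τ, hst, hστ, ?_⟩
    obtain ⟨y, ⟨hy1, hy2⟩, hy0⟩ := Submodule.exists_mem_ne_zero_of_ne_bot h3
    obtain ⟨b, rfl⟩ := (h.good₂.range y).1 hy2.1
    have hb1 : b 1 = 0 := (h.plane_iff b).1 hy1.1
    have hb : b = ![b 0, 0, b 2] := by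
      funext i
      fin_cases i <;> simp [hb1]
    have e2 := (h.good₂.mem_tangent_iff hστ b).1 hy2
    rw [hb, h.mulVec₂] at hy1
    have e1 := (h.good₁.mem_tangent_iff hst _).1 hy1
    simp only [Matrix.cons_val_zero, Matrix.cons_val_one, Matrix.cons_val] at e1
    rw [hb1] at e2
    -- Cramer's rule for `e1` and `e2`, whose determinant is the difference of the two sides of the
    -- edge equation.
    have key : b 0 * (s * (s - l * t) * σ ^ 2 - (s - t) * t * τ ^ 2) = 0 ∧
        b 2 * (s * (s - l * t) * σ ^ 2 - (s - t) * t * τ ^ 2) = 0 := by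
      constructor
      · linear_combination ((1 : ℂ) / 2) * σ ^ 2 * e1 - t * (s - t) * e2
      · linear_combination -((1 : ℂ) / 2) * τ ^ 2 * e1 + s * (s - l * t) * e2
    by_contra hne
    have hne' : s * (s - l * t) * σ ^ 2 - (s - t) * t * τ ^ 2 ≠ 0 := fun h => hne (sub_eq_zero.1 h)
    apply hy0
    have hb0 : b = 0 := by
      funext i
      fin_cases i
      · simpa [hne'] using key.1
      · exact hb1
      · simpa [hne'] using key.2
    rw [hb0, Matrix.mulVec_zero]
  · rintro ⟨s, t, σ, τ, hst, hστ, he⟩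
    unfold EdgeEq at he
    refine ⟨h.good₁.mem_points_iff.2 ⟨s, t, hst⟩, h.good₂.mem_points_iff.2 ⟨σ, τ, hστ⟩, ?_, ?_⟩
    -- A common point of the conics would lie on `L`, hence be one of the two points of `C₂ ∩ L`.
    -- These are the poles, which do not lie on `C₁`: for them `x z - y²` is `-l²` and `-1`.
    · intro hx
      have hmem := hστ.mem
      rw [← hx] at hmem
      obtain ⟨c, hc, hc'⟩ := exists_rep_eq_smul (h.good₁.veronese_ne_zero hst.ne) hst.mem
      obtain ⟨d, hd, hd'⟩ := exists_rep_eq_smul (h.good₂.veronese_ne_zero hστ.ne) hmem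
      have e : M₂ *ᵥ veronese σ τ = M₁ *ᵥ ((d⁻¹ * c) • veronese s t) := by
        rw [Matrix.mulVec_smul, mul_smul, ← hc', hd', inv_smul_smul₀ hd]
      have e1 : (veronese σ τ) 1 = 0 := by
        rw [← h.plane_iff, e]
        exact (h.good₁.range _).2 ⟨_, rfl⟩
      have e2 : veronese σ τ = ![σ ^ 2, 0, τ ^ 2] := by
        funext i
        fin_cases i
        · simp [veronese]
        · exact e1
        · simp [veronese]
      rw [e2, h.mulVec₂] at e
      have e3 := h.good₁.inj e
      have f0 := congrFun e3 0
      have f1 := congrFun e3 1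
      have f2 := congrFun e3 2
      simp [veronese] at e1 f0 f1 f2
      rcases e1 with rfl | rfl
      · have : τ ≠ 0 := by simpa using hστ.ne
        apply this
        have : τ ^ 4 = 0 := by
          linear_combination (-τ ^ 2 + (d⁻¹ * c * s * t)) * f1 - (d⁻¹ * c) * t ^ 2 * f0 +
            2 * τ ^ 2 * f2
        exact pow_eq_zero_iff (by norm_num) |>.1 this
      · have : σ ≠ 0 := by simpa using hστ.ne
        apply this
        have : (σ ^ 2 * l) ^ 2 = 0 := by
          linear_combination (σ ^ 2 * l + (d⁻¹ * c * s * t)) * f1 - (d⁻¹ * c) * t ^ 2 * f0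
        simpa [h.ne_zero] using this
    · rw [Submodule.ne_bot_iff]
      -- The point in which the tangent of `C₂` at `σ : τ` meets `L`.
      refine ⟨M₂ *ᵥ ![σ ^ 2, 0, -τ ^ 2], ⟨?_, ?_⟩, ?_⟩
      · rw [h.mulVec₂]
        refine (h.good₁.mem_tangent_iff hst _).2 ?_
        simp only [Matrix.cons_val_zero, Matrix.cons_val_one, Matrix.cons_val]
        linear_combination 2 * he
      · refine (h.good₂.mem_tangent_iff hστ _).2 ?_
        simp only [Matrix.cons_val_zero, Matrix.cons_val_one, Matrix.cons_val]
        ring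
      · apply h.good₂.mulVec_ne_zero
        intro h0
        have f0 := congrFun h0 0
        have f2 := congrFun h0 2
        simp at f0 f2
        have := hστ.ne
        tauto

/-- The stationary pairs are already Zariski closed: besides the equations of `C₁` and `C₂` they
satisfy only one more equation, which is bilinear. -/
theorem mem_edgeCurve_iff (h : Config C₁ C₂ M₁ M₂ k₁ k₂ l) (x : P3 × P3) :
    x ∈ edgeCurve C₁ C₂ ↔ ∃ s t σ τ, HasParam M₁ x.1 s t ∧ HasParam M₂ x.2 σ τ ∧
      EdgeEq l s t σ τ := by
  refine ⟨fun hx => ?_, fun hx => subset_zariskiClosure _ ((h.stationaryPairs_iff x).2 hx)⟩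
  have hl : ∀ i, (Sum.elim (fun _ => 1) (fun _ => 0) : Fin 4 ⊕ Fin 4 → ℕ) (Sum.inl i) = 1 ∧
      (Sum.elim (fun _ => 0) (fun _ => 1) : Fin 4 ⊕ Fin 4 → ℕ) (Sum.inl i) = 0 :=
    fun i => ⟨rfl, rfl⟩
  have hr : ∀ i, (Sum.elim (fun _ => 1) (fun _ => 0) : Fin 4 ⊕ Fin 4 → ℕ) (Sum.inr i) = 0 ∧
      (Sum.elim (fun _ => 0) (fun _ => 1) : Fin 4 ⊕ Fin 4 → ℕ) (Sum.inr i) = 1 :=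
    fun i => ⟨rfl, rfl⟩
  have h1 : x.1 ∈ C₁.points := by
    constructor
    · have := hx _ _ _ (isBihomogeneous_linear C₁.plane hl) (by
        intro y hy
        rw [evalBi_linear]
        exact hy.1.1)
      rw [evalBi_linear] at this
      exact this
    · have := hx _ _ _ (isBihomogeneous_bilinearPoly C₁.quad hl hl) (by
        intro y hy
        rw [evalBi_bilinearPoly]
        exact hy.1.2)
      rw [evalBi_bilinearPoly] at this
      exact this
  have h2 : x.2 ∈ C₂.points := by
    constructor
    · have := hx _ _ _ (isBihomogeneous_linear C₂.plane hr) (by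
        intro y hy
        rw [evalBi_linear]
        exact hy.2.1.1)
      rw [evalBi_linear] at this
      exact this
    · have := hx _ _ _ (isBihomogeneous_bilinearPoly C₂.quad hr hr) (by
        intro y hy
        rw [evalBi_bilinearPoly]
        exact hy.2.1.2)
      rw [evalBi_bilinearPoly] at this
      exact this
  obtain ⟨s, t, hst⟩ := h.good₁.mem_points_iff.1 h1
  obtain ⟨σ, τ, hστ⟩ := h.good₂.mem_points_iff.1 h2
  refine ⟨s, t, σ, τ, hst, hστ, ?_⟩
  -- The determinant that tests whether the polar forms of `u` and `v` restrict to proportional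
  -- linear forms on `L`, computed on the basis of `L` given by the two poles.
  obtain ⟨K, hK⟩ : ∃ K : Matrix (Fin 4) (Fin 4) ℂ, ∀ u v : Fin 4 → ℂ, u ⬝ᵥ (K *ᵥ v) =
      C₁.polar u (M₁ *ᵥ ![0, l, 2]) * C₂.polar v (M₂ *ᵥ ![0, 0, 1]) -
      C₁.polar u (-(M₁ *ᵥ ![2, 1, 0])) * C₂.polar v (M₂ *ᵥ ![1, 0, 0]) := by
    refine ⟨Matrix.vecMulVec (C₁.quad *ᵥ (M₁ *ᵥ ![0, l, 2])) (C₂.quad *ᵥ (M₂ *ᵥ ![0, 0, 1])) -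
      Matrix.vecMulVec (C₁.quad *ᵥ (-(M₁ *ᵥ ![2, 1, 0]))) (C₂.quad *ᵥ (M₂ *ᵥ ![1, 0, 0])), ?_⟩
    intro u v
    rw [Matrix.sub_mulVec, dotProduct_sub]
    simp only [Conic.polar, Matrix.vecMulVec_mulVec, dotProduct_smul]
    simp [dotProduct_comm v, mul_comm]
  have hval : ∀ (p q : P3) (s t σ τ : ℂ), HasParam M₁ p s t → HasParam M₂ q σ τ →
      (p.rep ⬝ᵥ (K *ᵥ q.rep) = 0 ↔ EdgeEq l s t σ τ) := by
    intro p q s t σ τ hst hστ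
    obtain ⟨c, hc, hc'⟩ := exists_rep_eq_smul (h.good₁.veronese_ne_zero hst.ne) hst.mem
    obtain ⟨d, hd, hd'⟩ := exists_rep_eq_smul (h.good₂.veronese_ne_zero hστ.ne) hστ.mem
    rw [hK, hc', hd', ← Matrix.mulVec_neg]
    simp only [Conic.polar_smul_left, h.good₁.form, h.good₂.form]
    simp only [veronese, Matrix.cons_val_zero, Matrix.cons_val_one, Matrix.cons_val, Pi.neg_apply]
    have hne : 2 * c * d * k₁ * k₂ ≠ 0 := by
      simp [hc, hd, h.good₁.ne_zero, h.good₂.ne_zero]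
    unfold EdgeEq
    constructor
    · intro h0
      apply sub_eq_zero.1
      apply (mul_eq_zero.1 (?_ : 2 * c * d * k₁ * k₂ * _ = 0)).resolve_left hne
      linear_combination h0
    · intro h0
      linear_combination 2 * c * d * k₁ * k₂ * h0
  rw [← hval _ _ _ _ _ _ hst hστ]
  have := hx _ _ _ (isBihomogeneous_bilinearPoly K hl hr) (by
    intro y hy
    obtain ⟨s', t', σ', τ', h1', h2', h3'⟩ := (h.stationaryPairs_iff y).1 hy
    rw [evalBi_bilinearPoly]
    exact (hval _ _ _ _ _ _ h1' h2').2 h3')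
  rw [evalBi_bilinearPoly] at this
  exact this

end Config

/-! ### The double cover -/

theorem EdgeEq.of_mul_eq_mul {l s t s' t' σ τ σ' τ' : ℂ} (h : EdgeEq l s t σ τ)
    (hst : s ≠ 0 ∨ t ≠ 0) (hst' : s' ≠ 0 ∨ t' ≠ 0) (hs : s * t' = s' * t)
    (hστ : σ ≠ 0 ∨ τ ≠ 0) (hστ' : σ' ≠ 0 ∨ τ' ≠ 0) (hσ : σ * τ' = σ' * τ) :
    EdgeEq l s' t' σ' τ' := by
  obtain ⟨c, -, rfl, rfl⟩ := exists_smul_of_mul_eq_mul hst hst' hs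
  obtain ⟨d, -, rfl, rfl⟩ := exists_smul_of_mul_eq_mul hστ hστ' hσ
  unfold EdgeEq at *
  linear_combination c ^ 2 * d ^ 2 * h

namespace Config

variable {C₁ C₂ : Conic ℂ} {M₁ M₂ : Matrix (Fin 4) (Fin 3) ℂ} {k₁ k₂ l : ℂ}

theorem mem_edgeCurve_iff_of_hasParam (h : Config C₁ C₂ M₁ M₂ k₁ k₂ l) {p q : P3} {s t σ τ : ℂ}
    (hp : HasParam M₁ p s t) (hq : HasParam M₂ q σ τ) :
    (p, q) ∈ edgeCurve C₁ C₂ ↔ EdgeEq l s t σ τ := by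
  rw [h.mem_edgeCurve_iff]
  constructor
  · rintro ⟨s', t', σ', τ', hp', hq', he⟩
    exact he.of_mul_eq_mul hp'.ne hp.ne (h.good₁.hasParam_unique hp' hp) hq'.ne hq.ne
      (h.good₂.hasParam_unique hq' hq)
  · intro he
    exact ⟨s, t, σ, τ, hp, hq, he⟩

theorem exists_hasParam_of_mem (h : Config C₁ C₂ M₁ M₂ k₁ k₂ l) {p q : P3}
    (hpq : (p, q) ∈ edgeCurve C₁ C₂) : ∃ σ τ, HasParam M₂ q σ τ := by
  obtain ⟨s, t, σ, τ, -, hq, -⟩ := (h.mem_edgeCurve_iff _).1 hpq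
  exact ⟨σ, τ, hq⟩

/-- Over `s : t` the edge equation is `A σ² = B τ²`. Since `0`, `l`, `1`, `∞` are distinct, `A` and
`B` do not vanish together. There is one solution if one of them is zero, and there are two opposite
solutions otherwise. -/
theorem isDoubleCoverBranchedOver (h : Config C₁ C₂ M₁ M₂ k₁ k₂ l) (S : Set P3)
    (hS : ∀ p s t, HasParam M₁ p s t → (p ∈ S ↔ s * (s - l * t) = 0 ∨ (s - t) * t = 0)) :
    IsDoubleCoverBranchedOver (edgeCurve C₁ C₂) C₁ S := by
  intro p hp
  obtain ⟨s, t, hst⟩ := h.good₁.mem_points_iff.1 hp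
  rw [hS p s t hst]
  obtain ⟨A, hA⟩ : ∃ A, A = s * (s - l * t) := ⟨_, rfl⟩
  obtain ⟨B, hB⟩ : ∃ B, B = (s - t) * t := ⟨_, rfl⟩
  have hAB : A = 0 → B = 0 → False := by
    intro h1 h2
    rw [h1, eq_comm, mul_eq_zero] at hA
    rw [h2, eq_comm, mul_eq_zero] at hB
    have hne := hst.ne
    have hl0 := h.ne_zero
    rcases hA with hA | hA <;> rcases hB with hB | hB
    · simp [hA] at hB hne
      exact hne hB
    · simp [hA, hB] at hne
    · have ht : t = s := by linear_combination -hB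
      subst ht
      have : t * (1 - l) = 0 := by linear_combination hA
      rcases mul_eq_zero.1 this with h3 | h3
      · simp [h3] at hne
      · exact h.ne_one (by linear_combination -h3)
    · rw [hB, mul_zero, sub_zero] at hA
      simp [hA, hB] at hne
  rw [← hA, ← hB]
  have hmem : ∀ q σ τ, HasParam M₂ q σ τ → ((p, q) ∈ edgeCurve C₁ C₂ ↔ A * σ ^ 2 = B * τ ^ 2) := by
    intro q σ τ hq
    rw [h.mem_edgeCurve_iff_of_hasParam hst hq, hA, hB, EdgeEq]
  constructor
  · rw [Set.ncard_eq_one]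
    rintro (h0 | h0)
    · obtain ⟨q, hq⟩ := h.good₂.exists_hasParam (s := 1) (t := 0) (by simp)
      refine ⟨q, Set.eq_singleton_iff_unique_mem.2 ⟨?_, ?_⟩⟩
      · refine (hmem _ _ _ hq).2 ?_
        simp [h0]
      · intro q' hq'
        obtain ⟨σ, τ, hστ⟩ := h.exists_hasParam_of_mem hq'
        have := (hmem _ _ _ hστ).1 hq'
        have hB0 : B ≠ 0 := hAB h0
        rw [h0, zero_mul, eq_comm, mul_eq_zero, or_iff_right hB0] at this
        apply h.good₂.hasParam_eq hστ hq
        simp [pow_eq_zero_iff two_ne_zero |>.1 this]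
    · obtain ⟨q, hq⟩ := h.good₂.exists_hasParam (s := 0) (t := 1) (by simp)
      refine ⟨q, Set.eq_singleton_iff_unique_mem.2 ⟨?_, ?_⟩⟩
      · refine (hmem _ _ _ hq).2 ?_
        simp [h0]
      · intro q' hq'
        obtain ⟨σ, τ, hστ⟩ := h.exists_hasParam_of_mem hq'
        have := (hmem _ _ _ hστ).1 hq'
        have hA0 : A ≠ 0 := fun h1 => hAB h1 h0
        rw [h0, zero_mul, mul_eq_zero, or_iff_right hA0] at this
        apply h.good₂.hasParam_eq hστ hq
        simpa using this
  · intro h0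
    rw [not_or] at h0
    obtain ⟨hA0, hB0⟩ := h0
    obtain ⟨r, hr⟩ := IsAlgClosed.exists_pow_nat_eq (B / A) two_pos
    have hr0 : r ≠ 0 := by
      rintro rfl
      exact div_ne_zero hB0 hA0 (by rw [← hr]; norm_num)
    have hr' : A * r ^ 2 = B := by rw [hr]; field_simp
    obtain ⟨q₁, hq₁⟩ := h.good₂.exists_hasParam (s := r) (t := 1) (by simp)
    obtain ⟨q₂, hq₂⟩ := h.good₂.exists_hasParam (s := r) (t := -1) (by simp)
    rw [Set.ncard_eq_two]
    refine ⟨q₁, q₂, ?_, ?_⟩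
    · rintro rfl
      have := h.good₂.hasParam_unique hq₁ hq₂
      apply hr0
      linear_combination -((1 : ℂ) / 2) * this
    · apply Set.eq_of_subset_of_subset
      · intro q hq
        obtain ⟨σ, τ, hστ⟩ := h.exists_hasParam_of_mem hq
        have h1 := (hmem _ _ _ hστ).1 hq
        have h2 : (σ * 1 - r * τ) * (σ * (-1) - r * τ) = 0 := by
          have : A * ((σ * 1 - r * τ) * (σ * (-1) - r * τ)) = 0 := by
            linear_combination -h1 + τ ^ 2 * hr'
          exact (mul_eq_zero.1 this).resolve_left hA0
        rcases mul_eq_zero.1 h2 with h3 | h3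
        · left
          exact h.good₂.hasParam_eq hστ hq₁ (by linear_combination h3)
        · right
          exact h.good₂.hasParam_eq hστ hq₂ (by linear_combination h3)
      · rintro q (rfl | rfl)
        · refine (hmem _ _ _ hq₁).2 ?_
          linear_combination hr'
        · refine (hmem _ _ _ hq₂).2 ?_
          linear_combination hr'

end Config

/-! ### The correspondence with the Legendre cubic -/

/-- The Legendre cubic `y² z = x (x - z) (x - l z)`. -/
def LegendreEq (l : ℂ) (v : Fin 3 → ℂ) : Prop :=
  v 1 ^ 2 * v 2 = v 0 * (v 0 - v 2) * (v 0 - l * v 2)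

/-- The closed relation expressing `s / t = x / z`. -/
def RelFst (l s t : ℂ) (v : Fin 3 → ℂ) : Prop :=
  v 0 * t = v 2 * s ∧ s * ((v 0 - v 2) * (v 0 - l * v 2)) = t * v 1 ^ 2

/-- The closed relation expressing `σ / τ = (x - z) / y`. -/
def RelSnd (l σ τ : ℂ) (v : Fin 3 → ℂ) : Prop :=
  (v 0 - v 2) * τ = v 1 * σ ∧ σ * (v 0 * (v 0 - l * v 2)) = τ * (v 1 * v 2)

/-- The graph of the isomorphism in coordinates. -/
structure GraphEq (l s t σ τ : ℂ) (v : Fin 3 → ℂ) : Prop where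
  legendre : LegendreEq l v
  fst : RelFst l s t v
  snd : RelSnd l σ τ v

section Algebra

variable {l s t σ τ s' t' σ' τ' : ℂ} {v : Fin 3 → ℂ}

theorem LegendreEq.smul (h : LegendreEq l v) (c : ℂ) : LegendreEq l (c • v) := by
  unfold LegendreEq at *
  simp only [Pi.smul_apply, smul_eq_mul]
  linear_combination c ^ 3 * h

theorem RelFst.smul (h : RelFst l s t v) (c : ℂ) : RelFst l s t (c • v) := by
  unfold RelFst at *
  simp only [Pi.smul_apply, smul_eq_mul]
  exact ⟨by linear_combination c * h.1, by linear_combination c ^ 2 * h.2⟩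

theorem RelSnd.smul (h : RelSnd l σ τ v) (c : ℂ) : RelSnd l σ τ (c • v) := by
  unfold RelSnd at *
  simp only [Pi.smul_apply, smul_eq_mul]
  exact ⟨by linear_combination c * h.1, by linear_combination c ^ 2 * h.2⟩

theorem GraphEq.smul (h : GraphEq l s t σ τ v) (c : ℂ) : GraphEq l s t σ τ (c • v) :=
  ⟨h.legendre.smul c, h.fst.smul c, h.snd.smul c⟩

theorem GraphEq.of_mul_eq_mul (h : GraphEq l s t σ τ v)
    (hst : s ≠ 0 ∨ t ≠ 0) (hst' : s' ≠ 0 ∨ t' ≠ 0) (hs : s * t' = s' * t)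
    (hστ : σ ≠ 0 ∨ τ ≠ 0) (hστ' : σ' ≠ 0 ∨ τ' ≠ 0) (hσ : σ * τ' = σ' * τ) :
    GraphEq l s' t' σ' τ' v := by
  obtain ⟨c, -, rfl, rfl⟩ := exists_smul_of_mul_eq_mul hst hst' hs
  obtain ⟨d, -, rfl, rfl⟩ := exists_smul_of_mul_eq_mul hστ hστ' hσ
  obtain ⟨h1, h2, h3⟩ := h
  unfold RelFst at h2
  unfold RelSnd at h3
  refine ⟨h1, ⟨?_, ?_⟩, ⟨?_, ?_⟩⟩
  · linear_combination c * h2.1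
  · linear_combination c * h2.2
  · linear_combination d * h3.1
  · linear_combination d * h3.2

/-- The first equation determines `s : t` unless `x = z = 0`. At that point `y ≠ 0`, and the second
equation forces `t = 0`. -/
theorem RelFst.unique (hv : v ≠ 0) (h : RelFst l s t v) (h' : RelFst l s' t' v) :
    s * t' = s' * t := by
  obtain ⟨h1, h2⟩ := h
  obtain ⟨h1', h2'⟩ := h'
  by_cases h0 : v 0 = 0
  · by_cases hz : v 2 = 0
    · have hy : v 1 ≠ 0 := by
        intro hy
        apply hv
        funext i
        fin_cases i <;> assumption
      rw [h0, hz] at h2 h2'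
      have e : t = 0 := by simpa [hy] using h2
      have e' : t' = 0 := by simpa [hy] using h2'
      rw [e, e']
      ring
    · apply mul_left_cancel₀ hz
      linear_combination -t' * h1 + t * h1'
  · apply mul_left_cancel₀ h0
    linear_combination -s' * h1 + s * h1'

/-- The first equation determines `σ : τ` unless `x = z` and `y = 0`. There the second equation
reads `σ x² (1 - l) = 0` with `x ≠ 0`, and `l ≠ 1` gives `σ = 0`. -/
theorem RelSnd.unique (hl : l ≠ 1) (hv : v ≠ 0) (h : RelSnd l σ τ v) (h' : RelSnd l σ' τ' v) :
    σ * τ' = σ' * τ := by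
  obtain ⟨h1, h2⟩ := h
  obtain ⟨h1', h2'⟩ := h'
  by_cases h0 : v 0 - v 2 = 0
  · by_cases hy : v 1 = 0
    · have hxz : v 2 = v 0 := by linear_combination -h0
      have hx : v 0 ≠ 0 := by
        intro hx
        apply hv
        rw [hx] at hxz
        funext i
        fin_cases i <;> assumption
      have hl' : v 0 - l * v 0 ≠ 0 := by
        intro h3
        have : v 0 * (1 - l) = 0 := by linear_combination h3
        rcases mul_eq_zero.1 this with h4 | h4
        · exact hx h4
        · exact hl (by linear_combination -h4)
      rw [hy, hxz] at h2 h2'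
      have e : σ = 0 := by simpa [hx, hl'] using h2
      have e' : σ' = 0 := by simpa [hx, hl'] using h2'
      rw [e, e']
      ring
    · apply mul_left_cancel₀ hy
      linear_combination -τ' * h1 + τ * h1'
  · apply mul_left_cancel₀ h0
    linear_combination -σ' * h1 + σ * h1'

/-- Substituting `s : t = x : z` and `σ : τ = (x - z) : y` turns the edge equation into a multiple
of the Legendre equation. The points `(0 : 1 : 0)` and `(1 : 0 : 1)`, where one of these ratios is
undefined, are treated by hand. -/
theorem GraphEq.edgeEq (hl : l ≠ 1) (hv : v ≠ 0) (h : GraphEq l s t σ τ v)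
    (hst : s ≠ 0 ∨ t ≠ 0) (hστ : σ ≠ 0 ∨ τ ≠ 0) : EdgeEq l s t σ τ := by
  obtain ⟨hW, h1, h2⟩ := h
  unfold EdgeEq
  have hx' : v 0 ≠ 0 ∨ v 2 ≠ 0 ∨ (v 0 = 0 ∧ v 2 = 0 ∧ v 1 ≠ 0) := by
    by_contra! h3
    apply hv
    funext i
    fin_cases i
    · exact h3.1
    · exact h3.2.2 h3.1 h3.2.1
    · exact h3.2.1
  unfold LegendreEq at hW
  rcases or_assoc.2 hx' with hx | ⟨hx, hz, hy⟩
  · obtain ⟨c, -, rfl, rfl⟩ := exists_smul_of_mul_eq_mul hx hst (by linear_combination h1.1)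
    by_cases hy : v 0 - v 2 ≠ 0 ∨ v 1 ≠ 0
    · obtain ⟨d, -, rfl, rfl⟩ := exists_smul_of_mul_eq_mul hy hστ (by linear_combination h2.1)
      linear_combination -c ^ 2 * d ^ 2 * (v 0 - v 2) * hW
    · push Not at hy
      have hxz : v 2 = v 0 := by linear_combination -hy.1
      have hx0 : v 0 ≠ 0 := by
        rw [hxz] at hx
        simpa using hx
      have hl' : v 0 - l * v 0 ≠ 0 := by
        intro h3
        have : v 0 * (1 - l) = 0 := by linear_combination h3
        rcases mul_eq_zero.1 this with h4 | h4
        · exact hx0 h4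
        · exact hl (by linear_combination -h4)
      have h4 := h2.2
      rw [hy.2, hxz] at h4
      have e : σ = 0 := by simpa [hx0, hl'] using h4
      rw [e, hxz]
      ring
  · have h3 := h1.2
    have h4 := h2.1
    rw [hx, hz] at h3 h4
    have e : t = 0 := by simpa [hy] using h3
    have e' : σ = 0 := by simpa [hy] using h4
    rw [e, e']
    ring

/-- For `σ t ≠ 0` the graph forces `v` to be proportional to `(s σ, (s - t) τ, t σ)`. On the edge
curve the remaining points have `σ = 0` and either `t = 0` or `s = t`; they correspond to `(0 : 1 :
0)` and `(1 : 0 : 1)`. -/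
theorem exists_smul_of_graphEq (hst : s ≠ 0 ∨ t ≠ 0) (hστ : σ ≠ 0 ∨ τ ≠ 0)
    (he : EdgeEq l s t σ τ) : ∃ u : Fin 3 → ℂ, ∀ v, GraphEq l s t σ τ v → ∃ c : ℂ, v = c • u := by
  by_cases hσ : σ = 0
  · subst hσ
    have hτ : τ ≠ 0 := by simpa using hστ
    by_cases ht : t = 0
    · subst ht
      have hs : s ≠ 0 := by simpa using hst
      refine ⟨![0, 1, 0], fun v hv => ⟨v 1, ?_⟩⟩
      have hz : v 2 = 0 := by simpa [hs] using hv.fst.1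
      have hx : v 0 = 0 := by simpa [hτ, hz] using hv.snd.1
      funext i
      fin_cases i <;> simp [hx, hz]
    · have hst' : s = t := by
        unfold EdgeEq at he
        have : (s - t) * (t * τ ^ 2) = 0 := by linear_combination -he
        simp [ht, hτ] at this
        linear_combination this
      subst hst'
      refine ⟨![1, 0, 1], fun v hv => ⟨v 0, ?_⟩⟩
      have hz : v 2 = v 0 := by
        apply mul_right_cancel₀ ht
        linear_combination -hv.fst.1
      have hy : v 1 = 0 := by
        have := hv.fst.2
        rw [hz] at this
        simpa [ht] using this
      funext i
      fin_cases i <;> simp [hz, hy]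
  · by_cases ht : t = 0
    · subst ht
      have hs : s ≠ 0 := by simpa using hst
      unfold EdgeEq at he
      simp [hs, hσ] at he
    · refine ⟨![s * σ, (s - t) * τ, t * σ], fun v hv => ⟨v 2 / (t * σ), ?_⟩⟩
      have h1 := hv.fst.1
      have h2 := hv.snd.1
      funext i
      fin_cases i
      · simp
        field_simp
        linear_combination h1
      · simp
        field_simp
        linear_combination -t * h2 + τ * h1
      · simp
        field_simp

/-! ### Explicit charts of the isomorphism in both directions -/

theorem graphEq_chart₁ (he : EdgeEq l s t σ τ) :
    GraphEq l s t σ τ ![s * σ, (s - t) * τ, t * σ] := by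
  unfold EdgeEq at he
  refine ⟨?_, ⟨?_, ?_⟩, ⟨?_, ?_⟩⟩
  · simp only [LegendreEq, Matrix.cons_val_zero, Matrix.cons_val_one, Matrix.cons_val]
    linear_combination -(s - t) * σ * he
  all_goals simp only [Matrix.cons_val_zero, Matrix.cons_val_one, Matrix.cons_val]
  · ring
  · linear_combination (s - t) * he
  · ring
  · linear_combination σ * he

/-- This second chart is needed only at `σ = 0`, `s = t`, the one point of the edge curve where the
first one vanishes. -/
theorem graphEq_chart₂ (he : EdgeEq l s t σ τ) :
    GraphEq l s t σ τ ![s * t * τ, s * (s - l * t) * σ, t ^ 2 * τ] := by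
  unfold EdgeEq at he
  refine ⟨?_, ⟨?_, ?_⟩, ⟨?_, ?_⟩⟩
  · simp only [LegendreEq, Matrix.cons_val_zero, Matrix.cons_val_one, Matrix.cons_val]
    linear_combination s * (s - l * t) * t ^ 2 * τ * he
  all_goals simp only [Matrix.cons_val_zero, Matrix.cons_val_one, Matrix.cons_val]
  · ring
  · linear_combination -s * t * (s - l * t) * he
  · linear_combination -he
  · ring

theorem exists_linear_ne_zero (h : s ≠ 0 ∨ t ≠ 0) : ∃ a b : ℂ, a * s + b * t ≠ 0 := by
  rcases h with h | h
  · exact ⟨1, 0, by simpa using h⟩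
  · exact ⟨0, 1, by simpa using h⟩

theorem dotProduct_vecMulVec_mulVec (a b u w : Fin 3 → ℂ) :
    a ⬝ᵥ (Matrix.vecMulVec u w *ᵥ b) =
      (a 0 * u 0 + a 1 * u 1 + a 2 * u 2) * (w 0 * b 0 + w 1 * b 1 + w 2 * b 2) := by
  simp [Matrix.vecMulVec_mulVec, dotProduct, Fin.sum_univ_three]
  ring

/-- Functions on the conics are polynomials in Veronese coordinates, hence of even degree in the
parameters. The charts have bidegrees `(1, 1)` and `(2, 1)`, so they are multiplied by linear forms
that do not vanish at the given point; this makes them bilinear in the two Veronese vectors. -/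
theorem exists_chart (l : ℂ) (hst : s ≠ 0 ∨ t ≠ 0) (hστ : σ ≠ 0 ∨ τ ≠ 0) :
    ∃ T : Fin 3 → Matrix (Fin 3) (Fin 3) ℂ,
      (fun i => veronese s t ⬝ᵥ (T i *ᵥ veronese σ τ)) ≠ 0 ∧
      ∀ s' t' σ' τ', EdgeEq l s' t' σ' τ' →
        GraphEq l s' t' σ' τ' fun i => veronese s' t' ⬝ᵥ (T i *ᵥ veronese σ' τ') := by
  obtain ⟨a, b, hab⟩ := exists_linear_ne_zero hst
  obtain ⟨c, d, hcd⟩ := exists_linear_ne_zero hστ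
  by_cases h0 : (![s * σ, (s - t) * τ, t * σ] : Fin 3 → ℂ) = 0
  · obtain ⟨U, W, e⟩ : ∃ U W : Fin 3 → Fin 3 → ℂ, ∀ s t σ τ : ℂ,
        (fun i => veronese s t ⬝ᵥ (Matrix.vecMulVec (U i) (W i) *ᵥ veronese σ τ)) =
        (c * σ + d * τ) • ![s * t * τ, s * (s - l * t) * σ, t ^ 2 * τ] := by
      -- Each component of the chart is a product of a quadratic form in `s`, `t` and one in `σ`,
      -- `τ`; the rows list the coefficients of these forms.
      refine ⟨![![0, 1, 0], ![1, -l, 0], ![0, 0, 1]],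
        ![![0, c, d], ![c, d, 0], ![0, c, d]], fun s t σ τ => ?_⟩
      funext i
      rw [dotProduct_vecMulVec_mulVec]
      fin_cases i <;> simp [veronese] <;> ring
    refine ⟨fun i => Matrix.vecMulVec (U i) (W i), ?_, fun s' t' σ' τ' h' => ?_⟩
    rotate_left
    · rw [e]
      exact (graphEq_chart₂ h').smul _
    · rw [e]
      refine smul_ne_zero hcd fun h1 => ?_
      have f0 := congrFun h0 0
      have f1 := congrFun h0 1
      have f2 := congrFun h0 2
      have g2 := congrFun h1 2
      simp at f0 f1 f2 g2
      have hσ : σ = 0 := by tauto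
      have hτ : τ ≠ 0 := by tauto
      have ht : t = 0 := by tauto
      have hs : s ≠ 0 := by tauto
      rw [ht, sub_zero] at f1
      tauto
  · obtain ⟨U, W, e⟩ : ∃ U W : Fin 3 → Fin 3 → ℂ, ∀ s t σ τ : ℂ,
        (fun i => veronese s t ⬝ᵥ (Matrix.vecMulVec (U i) (W i) *ᵥ veronese σ τ)) =
        ((a * s + b * t) * (c * σ + d * τ)) • ![s * σ, (s - t) * τ, t * σ] := by
      refine ⟨![![a, b, 0], ![a, b - a, -b], ![0, a, b]],
        ![![c, d, 0], ![0, c, d], ![c, d, 0]], fun s t σ τ => ?_⟩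
      funext i
      rw [dotProduct_vecMulVec_mulVec]
      fin_cases i <;> simp [veronese] <;> ring
    refine ⟨fun i => Matrix.vecMulVec (U i) (W i), ?_, fun s' t' σ' τ' h' => ?_⟩
    rotate_left
    · rw [e]
      exact (graphEq_chart₁ h').smul _
    · rw [e]
      exact smul_ne_zero (mul_ne_zero hab hcd) h0

/-- The pair `(x, z)` serves away from `(0 : 1 : 0)`, and `(y², (x - z) (x - l z))` serves there;
they agree on the cubic by the Legendre equation. -/
theorem exists_chart_fst (hv : v ≠ 0) : ∃ (d : ℕ) (A B : MvPolynomial (Fin 3) ℂ),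
    A.IsHomogeneous d ∧ B.IsHomogeneous d ∧
    (MvPolynomial.eval v A ≠ 0 ∨ MvPolynomial.eval v B ≠ 0) ∧
    ∀ w, LegendreEq l w → RelFst l (MvPolynomial.eval w A) (MvPolynomial.eval w B) w := by
  by_cases h : v 0 ≠ 0 ∨ v 2 ≠ 0
  · refine ⟨1, MvPolynomial.X 0, MvPolynomial.X 2, MvPolynomial.isHomogeneous_X _ _,
      MvPolynomial.isHomogeneous_X _ _, by simpa using h, fun w hw => ?_⟩
    unfold LegendreEq at hw
    simp only [RelFst, MvPolynomial.eval_X]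
    exact ⟨by ring, by linear_combination -hw⟩
  · push Not at h
    have hy : v 1 ≠ 0 := by
      intro hy
      apply hv
      funext i
      fin_cases i
      · exact h.1
      · exact hy
      · exact h.2
    refine ⟨2, MvPolynomial.X 1 ^ 2, (MvPolynomial.X 0 - MvPolynomial.X 2) *
      (MvPolynomial.X 0 - MvPolynomial.C l * MvPolynomial.X 2), ?_, ?_, ?_, ?_⟩
    · simpa using (MvPolynomial.isHomogeneous_X ℂ (1 : Fin 3)).pow 2
    · exact ((MvPolynomial.isHomogeneous_X ℂ (0 : Fin 3)).sub
        (MvPolynomial.isHomogeneous_X ℂ (2 : Fin 3))).mul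
        ((MvPolynomial.isHomogeneous_X ℂ (0 : Fin 3)).sub
          (MvPolynomial.isHomogeneous_C_mul_X l (2 : Fin 3)))
    · left
      simpa using hy
    · intro w hw
      unfold LegendreEq at hw
      simp only [RelFst, map_mul, map_sub, map_pow, MvPolynomial.eval_X, MvPolynomial.eval_C]
      exact ⟨by linear_combination -hw, by ring⟩

/-- The pair `(x - z, y)` serves away from `(1 : 0 : 1)`, and `(y z, x (x - l z))` serves there. -/
theorem exists_chart_snd (hl : l ≠ 1) (hv : v ≠ 0) : ∃ (d : ℕ) (A B : MvPolynomial (Fin 3) ℂ),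
    A.IsHomogeneous d ∧ B.IsHomogeneous d ∧
    (MvPolynomial.eval v A ≠ 0 ∨ MvPolynomial.eval v B ≠ 0) ∧
    ∀ w, LegendreEq l w → RelSnd l (MvPolynomial.eval w A) (MvPolynomial.eval w B) w := by
  by_cases h : v 0 - v 2 ≠ 0 ∨ v 1 ≠ 0
  · refine ⟨1, MvPolynomial.X 0 - MvPolynomial.X 2, MvPolynomial.X 1,
      (MvPolynomial.isHomogeneous_X _ _).sub (MvPolynomial.isHomogeneous_X _ _),
      MvPolynomial.isHomogeneous_X _ _, by simpa using h, fun w hw => ?_⟩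
    unfold LegendreEq at hw
    simp only [RelSnd, map_sub, MvPolynomial.eval_X]
    exact ⟨by ring, by linear_combination -hw⟩
  · push Not at h
    have hxz : v 2 = v 0 := by linear_combination -h.1
    have hx : v 0 ≠ 0 := by
      intro hx
      apply hv
      rw [hx] at hxz
      funext i
      fin_cases i
      · exact hx
      · exact h.2
      · exact hxz
    refine ⟨2, MvPolynomial.X 1 * MvPolynomial.X 2, MvPolynomial.X 0 *
      (MvPolynomial.X 0 - MvPolynomial.C l * MvPolynomial.X 2), ?_, ?_, ?_, ?_⟩
    · exact (MvPolynomial.isHomogeneous_X ℂ (1 : Fin 3)).mul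
        (MvPolynomial.isHomogeneous_X ℂ (2 : Fin 3))
    · exact (MvPolynomial.isHomogeneous_X ℂ (0 : Fin 3)).mul
        ((MvPolynomial.isHomogeneous_X ℂ (0 : Fin 3)).sub
          (MvPolynomial.isHomogeneous_C_mul_X l (2 : Fin 3)))
    · right
      simp only [map_mul, map_sub, MvPolynomial.eval_X, MvPolynomial.eval_C, hxz]
      refine mul_ne_zero hx fun h3 => ?_
      have : v 0 * (1 - l) = 0 := by linear_combination h3
      rcases mul_eq_zero.1 this with h4 | h4
      · exact hx h4
      · exact hl (by linear_combination -h4)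
    · intro w hw
      unfold LegendreEq at hw
      simp only [RelSnd, map_mul, map_sub, MvPolynomial.eval_X, MvPolynomial.eval_C]
      exact ⟨by linear_combination -hw, by ring⟩

theorem exists_eval_eq_mulVec_veronese (M : Matrix (Fin 4) (Fin 3) ℂ) {d : ℕ}
    {A B : MvPolynomial (Fin 3) ℂ} (hA : A.IsHomogeneous d) (hB : B.IsHomogeneous d) :
    ∃ G : Fin 4 → MvPolynomial (Fin 3) ℂ, (∀ i, (G i).IsHomogeneous (d + d)) ∧
      ∀ v, (fun i => MvPolynomial.eval v (G i)) =
        M *ᵥ veronese (MvPolynomial.eval v A) (MvPolynomial.eval v B) := by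
  refine ⟨fun i => MvPolynomial.C (M i 0) * (A * A) + MvPolynomial.C (M i 1) * (A * B) +
    MvPolynomial.C (M i 2) * (B * B), fun i => ?_, fun v => ?_⟩
  · exact (((hA.mul hA).C_mul _).add ((hA.mul hB).C_mul _)).add ((hB.mul hB).C_mul _)
  · funext i
    simp [Matrix.mulVec, dotProduct, Fin.sum_univ_three, veronese]
    ring

end Algebra

/-! ### The Legendre curve -/

/-- The Legendre curve `y² = x (x - 1) (x - l)`. -/
def legendreCurve (l : ℂ) : WeierstrassCurve ℂ := ⟨0, -(1 + l), 0, l, 0⟩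

theorem legendreCurve_Δ (l : ℂ) : (legendreCurve l).Δ = 16 * (l ^ 2 * (l - 1) ^ 2) := by
  simp only [legendreCurve, WeierstrassCurve.Δ, WeierstrassCurve.b₂, WeierstrassCurve.b₄,
    WeierstrassCurve.b₆, WeierstrassCurve.b₈]
  ring

theorem legendreCurve_isElliptic {l : ℂ} (h0 : l ≠ 0) (h1 : l ≠ 1) :
    (legendreCurve l).IsElliptic := by
  rw [WeierstrassCurve.isElliptic_iff, legendreCurve_Δ, isUnit_iff_ne_zero]
  exact mul_ne_zero (by norm_num)
    (mul_ne_zero (pow_ne_zero _ h0) (pow_ne_zero _ (sub_ne_zero.2 h1)))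

theorem legendreCurve_j {l : ℂ} (h0 : l ≠ 0) (h1 : l ≠ 1) (h : (legendreCurve l).IsElliptic) :
    (legendreCurve l).j = 2 ^ 8 * (l ^ 2 - l + 1) ^ 3 / (l ^ 2 * (l - 1) ^ 2) := by
  have h1' := sub_ne_zero.2 h1
  rw [WeierstrassCurve.j, Units.val_inv_eq_inv_val, WeierstrassCurve.coe_Δ', legendreCurve_Δ]
  simp only [legendreCurve, WeierstrassCurve.c₄, WeierstrassCurve.b₂, WeierstrassCurve.b₄]
  field_simp
  ring

theorem mem_weierstrassPoints_legendreCurve {l : ℂ} {w : P2} :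
    w ∈ weierstrassPoints (legendreCurve l) ↔ LegendreEq l w.rep := by
  change (legendreCurve l).toProjective.Equation w.rep ↔ _
  rw [WeierstrassCurve.Projective.equation_iff]
  simp only [legendreCurve, LegendreEq]
  constructor <;> intro h <;> linear_combination h

/-! ### The edge curve is isomorphic to the Legendre curve -/

/-- The graph of the isomorphism of the edge curve with the Legendre curve. -/
def GraphRel (l : ℂ) (M₁ M₂ : Matrix (Fin 4) (Fin 3) ℂ) (x : P3 × P3) (w : P2) : Prop :=
  ∃ s t σ τ v, HasParam M₁ x.1 s t ∧ HasParam M₂ x.2 σ τ ∧ v ≠ 0 ∧ v ∈ w.submodule ∧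
    EdgeEq l s t σ τ ∧ GraphEq l s t σ τ v

/-- A relation that is single-valued in both directions and has local polynomial sections defines
mutually inverse regular maps. The maps are picked by choice, and uniqueness identifies them with
every local formula. -/
theorem areIsomorphic_of_graph {X : Set (P3 × P3)} {Y : Set P2} {R : P3 × P3 → P2 → Prop}
    (hX : ∀ x w, R x w → x ∈ X) (hY : ∀ x w, R x w → w ∈ Y)
    (hX' : ∀ x w w', R x w → R x w' → w = w') (hY' : ∀ x x' w, R x w → R x' w → x = x')
    (hf : ∀ x ∈ X, ∃ (d e : ℕ) (F : Fin 3 → MvPolynomial (Fin 4 ⊕ Fin 4) ℂ),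
      (∀ i, IsBihomogeneous (F i) d e) ∧ (fun i => evalBi x (F i)) ≠ 0 ∧
      ∀ y ∈ X, ∀ hy : (fun i => evalBi y (F i)) ≠ 0,
        R y (Projectivization.mk ℂ (fun i => evalBi y (F i)) hy))
    (hg : ∀ w ∈ Y, ∃ x, R x w)
    (hg₁ : ∀ x ∈ Y, ∃ (d : ℕ) (G : Fin 4 → MvPolynomial (Fin 3) ℂ),
      (∀ i, (G i).IsHomogeneous d) ∧ (fun i => MvPolynomial.eval x.rep (G i)) ≠ 0 ∧
      ∀ z y, R z y → ∀ hy : (fun i => MvPolynomial.eval y.rep (G i)) ≠ 0,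
        z.1 = Projectivization.mk ℂ (fun i => MvPolynomial.eval y.rep (G i)) hy)
    (hg₂ : ∀ x ∈ Y, ∃ (d : ℕ) (G : Fin 4 → MvPolynomial (Fin 3) ℂ),
      (∀ i, (G i).IsHomogeneous d) ∧ (fun i => MvPolynomial.eval x.rep (G i)) ≠ 0 ∧
      ∀ z y, R z y → ∀ hy : (fun i => MvPolynomial.eval y.rep (G i)) ≠ 0,
        z.2 = Projectivization.mk ℂ (fun i => MvPolynomial.eval y.rep (G i)) hy) :
    AreIsomorphic X Y := by
  have hf' : ∀ x ∈ X, ∃ w, R x w := by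
    intro x hx
    obtain ⟨d, e, F, -, h1, h2⟩ := hf x hx
    exact ⟨_, h2 x hx h1⟩
  have : Nonempty P2 :=
    ⟨Projectivization.mk ℂ ![1, 0, 0] fun h => one_ne_zero (congrFun h 0)⟩
  have : Nonempty P3 :=
    ⟨Projectivization.mk ℂ ![1, 0, 0, 0] fun h => one_ne_zero (congrFun h 0)⟩
  choose! f hfR using hf'
  choose! g hgR using hg
  refine ⟨f, g, fun x hx => hY _ _ (hfR x hx), fun w hw => hX _ _ (hgR w hw), ?_, ?_, ?_, ?_, ?_⟩
  · intro x hx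
    exact hY' _ _ _ (hgR _ (hY _ _ (hfR x hx))) (hfR x hx)
  · intro w hw
    exact hX' _ _ _ (hfR _ (hX _ _ (hgR w hw))) (hgR w hw)
  · intro x hx
    obtain ⟨d, e, F, h0, h1, h2⟩ := hf x hx
    exact ⟨d, e, F, h0, h1, fun y hy hy' => hX' _ _ _ (hfR y hy) (h2 y hy hy')⟩
  · intro w hw
    obtain ⟨d, G, h0, h1, h2⟩ := hg₁ w hw
    exact ⟨d, G, h0, h1, fun y hy hy' => h2 _ _ (hgR y hy) hy'⟩
  · intro w hw
    obtain ⟨d, G, h0, h1, h2⟩ := hg₂ w hw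
    exact ⟨d, G, h0, h1, fun y hy hy' => h2 _ _ (hgR y hy) hy'⟩

theorem legendreEq_rep {l : ℂ} {w : P2} {v : Fin 3 → ℂ} (hv : v ≠ 0) (hw : v ∈ w.submodule)
    (h : LegendreEq l v) : LegendreEq l w.rep := by
  obtain ⟨c, -, hc⟩ := exists_rep_eq_smul hv hw
  rw [hc]
  exact h.smul c

theorem HasParam.eq_mk {M : Matrix (Fin 4) (Fin 3) ℂ}
    {p : P3} {s t a b : ℂ} (hp : HasParam M p s t) (he : a ≠ 0 ∨ b ≠ 0 → s * b = a * t)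
    {u : Fin 4 → ℂ} (hu : u ≠ 0) (hu' : u = M *ᵥ veronese a b) :
    p = Projectivization.mk ℂ u hu := by
  subst hu'
  have hab : a ≠ 0 ∨ b ≠ 0 := by
    by_contra! h
    apply hu
    have : veronese a b = 0 := by
      funext i
      fin_cases i <;> simp [veronese, h.1, h.2]
    rw [this, Matrix.mulVec_zero]
  exact (mk_eq_of_mem_submodule hu (hp.of_mul_eq_mul hab (he hab)).mem).symm

namespace Config

variable {C₁ C₂ : Conic ℂ} {M₁ M₂ : Matrix (Fin 4) (Fin 3) ℂ} {k₁ k₂ l : ℂ}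

theorem areIsomorphic (h : Config C₁ C₂ M₁ M₂ k₁ k₂ l) :
    AreIsomorphic (edgeCurve C₁ C₂) (weierstrassPoints (legendreCurve l)) := by
  have hg : ∀ w ∈ weierstrassPoints (legendreCurve l), ∃ x, GraphRel l M₁ M₂ x w := by
    intro w hw
    rw [mem_weierstrassPoints_legendreCurve] at hw
    obtain ⟨d, A, B, -, -, hAB, hR⟩ := exists_chart_fst (l := l) w.rep_nonzero
    obtain ⟨d', A', B', -, -, hAB', hR'⟩ := exists_chart_snd h.ne_one w.rep_nonzero
    obtain ⟨p, hp⟩ := h.good₁.exists_hasParam hAB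
    obtain ⟨q, hq⟩ := h.good₂.exists_hasParam hAB'
    have hG : GraphEq l _ _ _ _ w.rep := ⟨hw, hR _ hw, hR' _ hw⟩
    exact ⟨(p, q), _, _, _, _, w.rep, hp, hq, w.rep_nonzero, rep_mem_submodule w,
      hG.edgeEq h.ne_one w.rep_nonzero hp.ne hq.ne, hG⟩
  refine areIsomorphic_of_graph (R := GraphRel l M₁ M₂) ?_ ?_ ?_ ?_ ?_ hg ?_ ?_
  · rintro x w ⟨s, t, σ, τ, v, h1, h2, -, -, h3, -⟩
    exact (h.mem_edgeCurve_iff x).2 ⟨s, t, σ, τ, h1, h2, h3⟩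
  · rintro x w ⟨s, t, σ, τ, v, h1, h2, h3, h4, h5, h6⟩
    exact mem_weierstrassPoints_legendreCurve.2 (legendreEq_rep h3 h4 h6.legendre)
  · rintro x w w' ⟨s, t, σ, τ, v, h1, h2, h3, h4, h5, h6⟩
      ⟨s', t', σ', τ', v', h1', h2', h3', h4', h5', h6'⟩
    have h6'' := h6'.of_mul_eq_mul h1'.ne h1.ne (h.good₁.hasParam_unique h1' h1) h2'.ne h2.ne
      (h.good₂.hasParam_unique h2' h2)
    obtain ⟨u, hu⟩ := exists_smul_of_graphEq h1.ne h2.ne h5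
    obtain ⟨c, hc⟩ := hu v h6
    obtain ⟨c', hc'⟩ := hu v' h6''
    have hc0 : c ≠ 0 := by
      rintro rfl
      exact h3 (by rw [hc, zero_smul])
    refine eq_of_mem_submodule h3' ?_ h4'
    have : v' = (c' * c⁻¹) • v := by
      rw [hc, hc', smul_smul, mul_assoc, inv_mul_cancel₀ hc0, mul_one]
    rw [this]
    exact Submodule.smul_mem _ _ h4
  · rintro x x' w ⟨s, t, σ, τ, v, h1, h2, h3, h4, h5, h6⟩
      ⟨s', t', σ', τ', v', h1', h2', h3', h4', h5', h6'⟩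
    obtain ⟨c, -, hc⟩ := exists_rep_eq_smul h3 h4
    obtain ⟨c', -, hc'⟩ := exists_rep_eq_smul h3' h4'
    have g1 := h6.smul c
    have g2 := h6'.smul c'
    rw [← hc] at g1
    rw [← hc'] at g2
    exact Prod.ext (h.good₁.hasParam_eq h1 h1' (g1.fst.unique w.rep_nonzero g2.fst))
      (h.good₂.hasParam_eq h2 h2' (g1.snd.unique h.ne_one w.rep_nonzero g2.snd))
  · intro x hx
    obtain ⟨s, t, σ, τ, h1, h2, h3⟩ := (h.mem_edgeCurve_iff x).1 hx
    obtain ⟨T, hT, hT'⟩ := exists_chart l h1.ne h2.ne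
    obtain ⟨N₁, hN₁⟩ := exists_leftInverse h.good₁.inj
    obtain ⟨N₂, hN₂⟩ := exists_leftInverse h.good₂.inj
    -- The left inverses `N₁`, `N₂` recover the Veronese vectors linearly from coordinates in `ℙ³`,
    -- so a bilinear form in Veronese vectors becomes a polynomial of bidegree `(1, 1)`.
    have key : ∀ (y : P3 × P3) (s t σ τ : ℂ), HasParam M₁ y.1 s t → HasParam M₂ y.2 σ τ →
        ∃ c : ℂ, c ≠ 0 ∧ (fun i => evalBi y (bilinearPoly Sum.inl Sum.inr (N₁ᵀ * T i * N₂))) =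
          c • fun i => veronese s t ⬝ᵥ (T i *ᵥ veronese σ τ) := by
      intro y s t σ τ h1 h2
      obtain ⟨c, hc, hc'⟩ := exists_rep_eq_smul (h.good₁.veronese_ne_zero h1.ne) h1.mem
      obtain ⟨d, hd, hd'⟩ := exists_rep_eq_smul (h.good₂.veronese_ne_zero h2.ne) h2.mem
      refine ⟨c * d, mul_ne_zero hc hd, ?_⟩
      funext i
      rw [evalBi_bilinearPoly]
      change y.1.rep ⬝ᵥ (_ *ᵥ y.2.rep) = _
      rw [hc', hd', ← Matrix.mulVec_mulVec, ← Matrix.mulVec_mulVec, Matrix.mulVec_smul, hN₂,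
        Matrix.dotProduct_mulVec, Matrix.vecMul_transpose, Matrix.mulVec_smul, hN₁,
        Matrix.mulVec_smul]
      simp only [smul_dotProduct, dotProduct_smul, Pi.smul_apply, smul_eq_mul]
      ring
    refine ⟨_, _, fun i => bilinearPoly Sum.inl Sum.inr (N₁ᵀ * T i * N₂),
      fun i => isBihomogeneous_bilinearPoly _ (fun _ => ⟨rfl, rfl⟩) (fun _ => ⟨rfl, rfl⟩), ?_, ?_⟩
    · obtain ⟨c, hc, hc'⟩ := key x s t σ τ h1 h2
      rw [hc']
      exact smul_ne_zero hc hT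
    · intro y hy hy'
      obtain ⟨s', t', σ', τ', h1', h2', h3'⟩ := (h.mem_edgeCurve_iff y).1 hy
      refine ⟨s', t', σ', τ', _, h1', h2', hy', mem_submodule_mk hy', h3', ?_⟩
      obtain ⟨c, -, hc⟩ := key y s' t' σ' τ' h1' h2'
      rw [hc]
      exact (hT' _ _ _ _ h3').smul c
  · intro w _
    obtain ⟨d, A, B, hA, hB, hAB, hR⟩ := exists_chart_fst (l := l) w.rep_nonzero
    obtain ⟨G, hG, hG'⟩ := exists_eval_eq_mulVec_veronese M₁ hA hB
    refine ⟨_, G, hG, ?_, ?_⟩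
    · rw [hG']
      exact h.good₁.veronese_ne_zero hAB
    · rintro z y ⟨s, t, σ, τ, v, h1, h2, h3, h4, h5, h6⟩ hy
      refine h1.eq_mk (fun _ => ?_) hy (hG' _)
      obtain ⟨c, -, hc⟩ := exists_rep_eq_smul h3 h4
      have g1 := h6.smul c
      rw [← hc] at g1
      exact g1.fst.unique y.rep_nonzero (hR _ g1.legendre)
  · intro w _
    obtain ⟨d, A, B, hA, hB, hAB, hR⟩ := exists_chart_snd h.ne_one w.rep_nonzero
    obtain ⟨G, hG, hG'⟩ := exists_eval_eq_mulVec_veronese M₂ hA hB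
    refine ⟨_, G, hG, ?_, ?_⟩
    · rw [hG']
      exact h.good₂.veronese_ne_zero hAB
    · rintro z y ⟨s, t, σ, τ, v, h1, h2, h3, h4, h5, h6⟩ hy
      refine h2.eq_mk (fun _ => ?_) hy (hG' _)
      obtain ⟨c, -, hc⟩ := exists_rep_eq_smul h3 h4
      have g1 := h6.smul c
      rw [← hc] at g1
      exact g1.snd.unique h.ne_one y.rep_nonzero (hR _ g1.legendre)

theorem hasJInvariant (h : Config C₁ C₂ M₁ M₂ k₁ k₂ l) :
    HasJInvariant (edgeCurve C₁ C₂) (2 ^ 8 * (l ^ 2 - l + 1) ^ 3 / (l ^ 2 * (l - 1) ^ 2)) :=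
  ⟨legendreCurve l, legendreCurve_isElliptic h.ne_zero h.ne_one,
    legendreCurve_j h.ne_zero h.ne_one _, h.areIsomorphic⟩

/-- The four branch points have the parameters `0`, `1`, `l`, `∞`. -/
theorem edgeCurveBranchedOver (h : Config C₁ C₂ M₁ M₂ k₁ k₂ l) {a b c d : P3}
    (ha : HasParam M₁ a 0 1) (hb : HasParam M₁ b 1 1) (hc : HasParam M₁ c l 1)
    (hd : HasParam M₁ d 1 0) : EdgeCurveBranchedOver C₁ C₂ {a, b, c, d} := by
  refine ⟨h.span_ne, h.isDoubleCoverBranchedOver _ fun p s t hp => ?_, l, h.ne_zero, h.ne_one,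
    ⟨M₁, a, b, c, d, h.good₁.isParametrization, rfl, ?_, ?_, ?_, ?_⟩, h.hasJInvariant⟩
  · have key : ∀ {q : P3} {s' t' : ℂ}, HasParam M₁ q s' t' → (p = q ↔ s * t' = s' * t) := by
      intro q s' t' hq
      refine ⟨?_, fun he => h.good₁.hasParam_eq hp hq he⟩
      rintro rfl
      exact h.good₁.hasParam_unique hp hq
    simp only [Set.mem_insert_iff, Set.mem_singleton_iff, key ha, key hb, key hc, key hd,
      mul_eq_zero, mul_one, mul_zero, zero_mul, one_mul, sub_eq_zero, eq_comm (a := (0 : ℂ))]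
    tauto
  · simpa [veronese] using ha.mem
  · simpa [veronese] using hb.mem
  · simpa [veronese] using hc.mem
  · simpa [veronese] using hd.mem

end Config

/-! ### Existence of parametrizations -/

theorem exists_isotropic (C : Conic ℂ) :
    ∃ P, P ≠ 0 ∧ C.plane ⬝ᵥ P = 0 ∧ C.polar P P = 0 := by
  obtain ⟨x, hx, hx'⟩ := exists_mem_span_not_mem C 0 0
  obtain ⟨y, hy, hy'⟩ := exists_mem_span_not_mem C x 0
  by_cases h : C.polar x x = 0
  · exact ⟨x, by simpa using hx', hx, h⟩
  · obtain ⟨a, ha⟩ := exists_quadratic_eq_zero (b := 2 * C.polar x y)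
      (c := C.polar y y) h ⟨_, (IsAlgClosed.exists_pow_nat_eq _ two_pos).choose_spec.symm.trans
        (sq _)⟩
    refine ⟨a • x + y, ?_, by simp [hx, hy], ?_⟩
    · intro h0
      apply hy' (-a) 0
      rw [neg_smul, smul_zero, add_zero]
      exact (neg_eq_of_add_eq_zero_right h0).symm
    · simp only [C.polar_add_left, C.polar_add_right, C.polar_smul_left, C.polar_smul_right,
        C.polar_comm y x]
      linear_combination ha

theorem exists_isGood_of_conic (C : Conic ℂ) : ∃ M k, IsGood C M k := by
  obtain ⟨P, hP0, hP, hPP⟩ := exists_isotropic C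
  obtain ⟨R, hR, hb⟩ : ∃ R, C.plane ⬝ᵥ R = 0 ∧ C.polar P R ≠ 0 := by
    by_contra! h
    exact hP0 (C.eq_zero_of_polar P hP h)
  -- Correcting `R` by a multiple of the isotropic vector `P` makes it isotropic without changing
  -- its product with `P`.
  obtain ⟨Q, hQdef⟩ : ∃ Q, Q = R + (-C.polar R R / (2 * C.polar P R)) • P := ⟨_, rfl⟩
  have hPQ : C.polar P Q = C.polar P R := by
    rw [hQdef, C.polar_add_right, C.polar_smul_right, hPP, mul_zero, add_zero]
  have hQQ : C.polar Q Q = 0 := by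
    rw [hQdef]
    simp only [C.polar_add_left, C.polar_add_right, C.polar_smul_left, C.polar_smul_right,
        C.polar_comm R P, hPP]
    field_simp
    ring
  have hQ : C.plane ⬝ᵥ Q = 0 := by simp [hQdef, hP, hR]
  obtain ⟨M, k, hM, -⟩ := exists_isGood C P Q hP hQ hPP hQQ (by
    intro a b hab
    have h1 : C.polar P (a • P + b • Q) = 0 := by rw [hab]; simp [Conic.polar]
    have h2 : C.polar Q (a • P + b • Q) = 0 := by rw [hab]; simp [Conic.polar]
    rw [C.polar_add_right, C.polar_smul_right, C.polar_smul_right, hPP, hPQ] at h1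
    rw [C.polar_add_right, C.polar_smul_right, C.polar_smul_right, hQQ, C.polar_comm Q, hPQ] at h2
    constructor
    · simpa [hb] using h2
    · simpa [hb] using h1)
  exact ⟨M, k, hM⟩

theorem IsGood.rescale {C : Conic ℂ} {M : Matrix (Fin 4) (Fin 3) ℂ} {k s t : ℂ}
    (hM : IsGood C M k) (hs : s ≠ 0) (ht : t ≠ 0) :
    ∃ M' k', IsGood C M' k' ∧ ∀ x y, M' *ᵥ veronese x y = M *ᵥ veronese (s * x) (t * y) := by
  have hmul : ∀ a, (M * Matrix.diagonal ![s ^ 2, s * t, t ^ 2]) *ᵥ a =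
      M *ᵥ ![s ^ 2 * a 0, s * t * a 1, t ^ 2 * a 2] := by
    intro a
    rw [← Matrix.mulVec_mulVec]
    congr 1
    funext i
    fin_cases i <;> simp [Matrix.mulVec_diagonal]
  refine ⟨M * Matrix.diagonal ![s ^ 2, s * t, t ^ 2], k * (s * t) ^ 2, ⟨?_, ?_, ?_, ?_⟩, ?_⟩
  · exact mul_ne_zero hM.ne_zero (pow_ne_zero _ (mul_ne_zero hs ht))
  · apply mulVec_injective_of
    intro a ha
    rw [hmul] at ha
    have h1 := hM.inj (ha.trans (Matrix.mulVec_zero M).symm)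
    have h0 := congrFun h1 0
    have h2 := congrFun h1 1
    have h3 := congrFun h1 2
    simp [hs, ht] at h0 h2 h3
    funext i
    fin_cases i <;> assumption
  · intro x
    rw [hM.range]
    constructor
    · rintro ⟨a, rfl⟩
      refine ⟨![a 0 / s ^ 2, a 1 / (s * t), a 2 / t ^ 2], ?_⟩
      rw [hmul]
      congr 1
      funext i
      fin_cases i <;> simp <;> field_simp
    · rintro ⟨a, rfl⟩
      exact ⟨_, (hmul a).symm⟩
  · intro a b
    rw [hmul, hmul, hM.form]
    simp
    ring
  · intro x y
    rw [hmul]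
    congr 1
    funext i
    fin_cases i <;> simp [veronese] <;> ring

/-- Three points can be moved to `0`, `1`, `∞`: the parametrization is built on `a` and `d`, and a
diagonal rescaling sends `b` to `1`. The parameter of `c` is then `l`. -/
theorem exists_isGood_of_points (C : Conic ℂ) {a b c d : P3} (ha : a ∈ C.points)
    (hb : b ∈ C.points) (hc : c ∈ C.points) (hd : d ∈ C.points) (hab : a ≠ b) (hac : a ≠ c)
    (had : a ≠ d) (hbc : b ≠ c) (hbd : b ≠ d) (hcd : c ≠ d) :
    ∃ M k l, IsGood C M k ∧ l ≠ 0 ∧ l ≠ 1 ∧ HasParam M a 0 1 ∧ HasParam M b 1 1 ∧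
      HasParam M c l 1 ∧ HasParam M d 1 0 := by
  obtain ⟨M, k, hM, h0, h2⟩ := exists_isGood C d.rep a.rep hd.1 ha.1 hd.2 ha.2 (by
    intro x y hxy
    by_contra hne
    have hne' : x ≠ 0 ∨ y ≠ 0 := by tauto
    apply had
    rcases hne' with h | h
    · refine (eq_of_mem_submodule d.rep_nonzero (rep_mem_submodule d) ?_).symm
      have : d.rep = (-(x⁻¹ * y)) • a.rep := by
        have h1 : x⁻¹ • (x • d.rep + y • a.rep) = 0 := by rw [hxy, smul_zero]
        rw [smul_add, inv_smul_smul₀ h, smul_smul] at h1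
        rw [neg_smul]
        exact eq_neg_of_add_eq_zero_left h1
      rw [this]
      exact Submodule.smul_mem _ _ (rep_mem_submodule a)
    · refine eq_of_mem_submodule a.rep_nonzero (rep_mem_submodule a) ?_
      have : a.rep = (-(y⁻¹ * x)) • d.rep := by
        have h1 : y⁻¹ • (x • d.rep + y • a.rep) = 0 := by rw [hxy, smul_zero]
        rw [smul_add, inv_smul_smul₀ h, smul_smul] at h1
        rw [neg_smul]
        exact eq_neg_of_add_eq_zero_right h1
      rw [this]
      exact Submodule.smul_mem _ _ (rep_mem_submodule d))
  have ha' : HasParam M a 0 1 := by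
    refine ⟨by simp, ?_⟩
    have : veronese 0 1 = ![0, 0, 1] := by simp [veronese]
    rw [this, h2]
    exact rep_mem_submodule a
  have hd' : HasParam M d 1 0 := by
    refine ⟨by simp, ?_⟩
    have : veronese 1 0 = ![1, 0, 0] := by simp [veronese]
    rw [this, h0]
    exact rep_mem_submodule d
  obtain ⟨s, t, hst⟩ := hM.mem_points_iff.1 hb
  have hs : s ≠ 0 := by
    rintro rfl
    exact hab (hM.hasParam_eq ha' hst (by simp))
  have ht : t ≠ 0 := by
    rintro rfl
    exact hbd (hM.hasParam_eq hst hd' (by simp))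
  obtain ⟨M', k', hM', hMM'⟩ := hM.rescale hs ht
  have htrans : ∀ {p x y}, (x ≠ 0 ∨ y ≠ 0) → HasParam M p (s * x) (t * y) → HasParam M' p x y :=
    fun hne h => ⟨hne, by rw [hMM']; exact h.mem⟩
  have ha'' : HasParam M' a 0 1 :=
    htrans (by simp) (ha'.of_mul_eq_mul (by simp [ht]) (by simp))
  have hb'' : HasParam M' b 1 1 :=
    htrans (by simp) (hst.of_mul_eq_mul (by simp [ht]) (by ring))
  have hd'' : HasParam M' d 1 0 :=
    htrans (by simp) (hd'.of_mul_eq_mul (by simp [hs]) (by simp))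
  obtain ⟨x, y, hxy⟩ := hM'.mem_points_iff.1 hc
  have hy : y ≠ 0 := by
    rintro rfl
    exact hcd (hM'.hasParam_eq hxy hd'' (by simp))
  have hc'' : HasParam M' c (x / y) 1 := hxy.of_mul_eq_mul (by simp) (by field_simp)
  refine ⟨M', k', x / y, hM', ?_, ?_, ha'', hb'', hc'', hd''⟩
  · intro h
    rw [h] at hc''
    exact hac (hM'.hasParam_eq ha'' hc'' rfl)
  · intro h
    rw [h] at hc''
    exact hbc (hM'.hasParam_eq hb'' hc'' rfl)

/-! ### Existence of conics -/

/-- The form `x z - y²` is transported by a left inverse of `M`, and the plane is the image of `M`.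
-/
theorem exists_conic_isGood {M : Matrix (Fin 4) (Fin 3) ℂ} (hM : Function.Injective M.mulVec) :
    ∃ C : Conic ℂ, IsGood C M 1 := by
  obtain ⟨N, hN⟩ := exists_leftInverse hM
  obtain ⟨φ, hφ0, hφ⟩ : ∃ φ : Fin 4 → ℂ, φ ≠ 0 ∧ ∀ a, φ ⬝ᵥ (M *ᵥ a) = 0 := by
    obtain ⟨g, hg0, hg⟩ := Submodule.exists_le_ker_of_lt_top (LinearMap.range M.mulVecLin) (by
      rw [lt_top_iff_ne_top]
      intro h
      have h1 := LinearMap.finrank_range_of_inj (f := M.mulVecLin) hM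
      rw [h, finrank_top] at h1
      simp at h1)
    have hgφ : ∀ x, g x = (fun i => g (Pi.single i 1)) ⬝ᵥ x := by
      intro x
      conv_lhs => rw [← Finset.univ_sum_single x]
      rw [map_sum]
      refine Finset.sum_congr rfl fun i _ => ?_
      have : (Pi.single i (x i) : Fin 4 → ℂ) = x i • Pi.single i 1 := by
        rw [← Pi.single_smul, smul_eq_mul, mul_one]
      rw [this, map_smul, smul_eq_mul, mul_comm]
    refine ⟨fun i => g (Pi.single i 1), ?_, fun a => ?_⟩
    · intro h
      apply hg0
      refine LinearMap.ext fun x => ?_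
      rw [hgφ, h, zero_dotProduct, LinearMap.zero_apply]
    · rw [← hgφ]
      exact hg ⟨a, rfl⟩
  let J : Matrix (Fin 3) (Fin 3) ℂ := !![0, 0, 1; 0, -2, 0; 1, 0, 0]
  have hJ : ∀ a b : Fin 3 → ℂ, a ⬝ᵥ (J *ᵥ b) = a 0 * b 2 + a 2 * b 0 - 2 * a 1 * b 1 := by
    intro a b
    simp [J, dotProduct, Matrix.mulVec, Fin.sum_univ_three]
    ring
  have hform : ∀ x y, x ⬝ᵥ ((Nᵀ * J * N) *ᵥ y) = (N *ᵥ x) ⬝ᵥ (J *ᵥ (N *ᵥ y)) := by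
    intro x y
    rw [← Matrix.mulVec_mulVec, ← Matrix.mulVec_mulVec, Matrix.dotProduct_mulVec,
      Matrix.vecMul_transpose]
  refine ⟨⟨φ, Nᵀ * J * N, hφ0, ?_, ?_⟩, ⟨one_ne_zero, hM, ?_, ?_⟩⟩
  · have hJs : Jᵀ = J := by
      ext i j
      fin_cases i <;> fin_cases j <;> simp [J]
    unfold Matrix.IsSymm
    rw [Matrix.transpose_mul, Matrix.transpose_mul, Matrix.transpose_transpose, hJs,
      Matrix.mul_assoc]
  · intro x hx h
    obtain ⟨a, rfl⟩ := exists_of_injective hφ0 hM hφ x hx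
    have key : ∀ b : Fin 3 → ℂ, a 0 * b 2 + a 2 * b 0 - 2 * a 1 * b 1 = 0 := by
      intro b
      have := h (M *ᵥ b) (hφ b)
      rwa [hform, hN, hN, hJ] at this
    have h0 := key ![1, 0, 0]
    have h1 := key ![0, 1, 0]
    have h2 := key ![0, 0, 1]
    simp at h0 h1 h2
    have : a = 0 := by
      funext i
      fin_cases i <;> assumption
    rw [this, Matrix.mulVec_zero]
  · intro x
    refine ⟨exists_of_injective hφ0 hM hφ x, ?_⟩
    rintro ⟨a, rfl⟩
    exact hφ a
  · intro a b
    rw [one_mul, ← hJ]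
    change _ ⬝ᵥ ((Nᵀ * J * N) *ᵥ _) = _
    rw [hform, hN, hN]

theorem poles_independent {M : Matrix (Fin 4) (Fin 3) ℂ} (hM : Function.Injective M.mulVec)
    (l a b : ℂ) (h : a • (M *ᵥ ![0, l, 2]) + b • -(M *ᵥ ![2, 1, 0]) = 0) : a = 0 ∧ b = 0 := by
  rw [← Matrix.mulVec_neg, ← Matrix.mulVec_smul, ← Matrix.mulVec_smul, ← Matrix.mulVec_add] at h
  have h1 := hM (h.trans (Matrix.mulVec_zero M).symm)
  have e0 := congrFun h1 0
  have e2 := congrFun h1 2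
  simp at e0 e2
  exact ⟨e2, e0⟩

/-- Passing through the two poles in a different plane is all that is asked of `C₂`. This freedom is
what later allows a circle. -/
theorem config_of_mem {C₁ C₂ : Conic ℂ} {M₁ : Matrix (Fin 4) (Fin 3) ℂ} {k₁ l : ℂ}
    (h₁ : IsGood C₁ M₁ k₁) (h0 : l ≠ 0) (h1 : l ≠ 1) (hspan : C₁.span ≠ C₂.span)
    (hP : C₂.plane ⬝ᵥ (M₁ *ᵥ ![0, l, 2]) = 0) (hQ : C₂.plane ⬝ᵥ (M₁ *ᵥ ![2, 1, 0]) = 0)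
    (hPP : C₂.polar (M₁ *ᵥ ![0, l, 2]) (M₁ *ᵥ ![0, l, 2]) = 0)
    (hQQ : C₂.polar (M₁ *ᵥ ![2, 1, 0]) (M₁ *ᵥ ![2, 1, 0]) = 0) :
    ∃ M₂ k₂, Config C₁ C₂ M₁ M₂ k₁ k₂ l := by
  obtain ⟨M₂, k₂, h₂, e0, e2⟩ := exists_isGood C₂ (M₁ *ᵥ ![0, l, 2]) (-(M₁ *ᵥ ![2, 1, 0])) hP
    (by rw [dotProduct_neg, hQ, neg_zero]) hPP
    (by rw [← neg_one_smul ℂ, C₂.polar_smul_left, C₂.polar_smul_right, hQQ]; ring)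
    (fun a b => poles_independent h₁.inj l a b)
  exact ⟨M₂, k₂, h₁, h₂, h0, h1, e0, e2, hspan⟩

theorem exists_config {C₁ : Conic ℂ} {M₁ : Matrix (Fin 4) (Fin 3) ℂ} {k₁ l : ℂ}
    (h₁ : IsGood C₁ M₁ k₁) (h0 : l ≠ 0) (h1 : l ≠ 1) :
    ∃ C₂ M₂ k₂, Config C₁ C₂ M₁ M₂ k₁ k₂ l := by
  -- Any vector outside the plane of `C₁` spans, together with the two poles, a plane for `C₂`.
  obtain ⟨R, hR⟩ : ∃ R, C₁.plane ⬝ᵥ R ≠ 0 := by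
    by_contra! h
    exact C₁.plane_ne_zero (dotProduct_eq_zero _ h)
  have hcol : C₁.plane ⬝ᵥ (M₁ *ᵥ ![0, l, 2]) = 0 ∧ C₁.plane ⬝ᵥ (-(M₁ *ᵥ ![2, 1, 0])) = 0 := by
    rw [dotProduct_neg, neg_eq_zero]
    exact ⟨(h₁.range _).2 ⟨_, rfl⟩, (h₁.range _).2 ⟨_, rfl⟩⟩
  have hM₂ : Function.Injective (columns (M₁ *ᵥ ![0, l, 2]) R (-(M₁ *ᵥ ![2, 1, 0]))).mulVec := by
    apply mulVec_injective_of
    intro a ha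
    rw [columns_mulVec] at ha
    have e1 : a 1 = 0 := by
      have := congrArg (C₁.plane ⬝ᵥ ·) ha
      simpa only [dotProduct_add, dotProduct_smul, hcol.1, hcol.2, dotProduct_zero, smul_eq_mul,
        mul_zero, zero_add, add_zero, mul_eq_zero, hR, or_false] using this
    rw [e1, zero_smul, add_zero] at ha
    obtain ⟨e0, e2⟩ := poles_independent h₁.inj l _ _ ha
    funext i
    fin_cases i <;> assumption
  obtain ⟨C₂, h₂⟩ := exists_conic_isGood hM₂
  refine ⟨C₂, _, 1, h₁, h₂, h0, h1, ?_, ?_, ?_⟩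
  · simp [columns_mulVec]
  · simp [columns_mulVec]
  · intro h
    have : R ∈ C₂.span := (h₂.range R).2 ⟨![0, 1, 0], by simp [columns_mulVec]⟩
    rw [← h] at this
    exact hR this

theorem exists_legendre_parameter (J : ℂ) :
    ∃ l : ℂ, l ≠ 0 ∧ l ≠ 1 ∧ 2 ^ 8 * (l ^ 2 - l + 1) ^ 3 / (l ^ 2 * (l - 1) ^ 2) = J := by
  obtain ⟨l, hl⟩ := IsAlgClosed.exists_root
    (Polynomial.C (2 ^ 8) * (Polynomial.X ^ 2 - Polynomial.X + 1) ^ 3 -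
      Polynomial.C J * (Polynomial.X ^ 2 * (Polynomial.X - 1) ^ 2) : Polynomial ℂ) (by
    have : (Polynomial.C (2 ^ 8) * (Polynomial.X ^ 2 - Polynomial.X + 1) ^ 3 -
      Polynomial.C J * (Polynomial.X ^ 2 * (Polynomial.X - 1) ^ 2) : Polynomial ℂ).degree = 6 := by
      compute_degree!
    rw [this]
    norm_num)
  simp only [Polynomial.IsRoot, Polynomial.eval_sub, Polynomial.eval_mul, Polynomial.eval_C,
    Polynomial.eval_pow, Polynomial.eval_add, Polynomial.eval_X, Polynomial.eval_one] at hl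
  -- At `0` and at `1` the polynomial has the value `2 ^ 8`, whatever `J` is.
  have h0 : l ≠ 0 := by
    rintro rfl
    norm_num at hl
  have h1 : l ≠ 1 := by
    rintro rfl
    norm_num at hl
  refine ⟨l, h0, h1, ?_⟩
  have h1' := sub_ne_zero.2 h1
  rw [div_eq_iff (mul_ne_zero (pow_ne_zero _ h0) (pow_ne_zero _ h1'))]
  linear_combination hl

theorem exists_conic_hasJInvariant (C₁ : Conic ℂ) (J : ℂ) :
    ∃ C₂ : Conic ℂ, C₁.span ≠ C₂.span ∧ HasJInvariant (edgeCurve C₁ C₂) J := by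
  obtain ⟨M₁, k₁, h₁⟩ := exists_isGood_of_conic C₁
  obtain ⟨l, h0, h1, rfl⟩ := exists_legendre_parameter J
  obtain ⟨C₂, M₂, k₂, h⟩ := exists_config h₁ h0 h1
  exact ⟨C₂, h.span_ne, h.hasJInvariant⟩

theorem exists_edgeCurveBranchedOver (C₁ : Conic ℂ) {a b c d : P3}
    (hS : {a, b, c, d} ⊆ C₁.points) (hab : a ≠ b) (hac : a ≠ c)
    (had : a ≠ d) (hbc : b ≠ c) (hbd : b ≠ d) (hcd : c ≠ d) :
    ∃ C₂ : Conic ℂ, EdgeCurveBranchedOver C₁ C₂ {a, b, c, d} := by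
  obtain ⟨M₁, k₁, l, h₁, h0, h1, ha, hb, hc, hd⟩ := exists_isGood_of_points C₁
    (hS (by simp)) (hS (by simp)) (hS (by simp)) (hS (by simp)) hab hac had hbc hbd hcd
  obtain ⟨C₂, M₂, k₂, h⟩ := exists_config h₁ h0 h1
  exact ⟨C₂, h.edgeCurveBranchedOver ha hb hc hd⟩

/-! ### Poles of pairs of points -/

theorem IsGood.mem_tangents_iff {C : Conic ℂ} {M : Matrix (Fin 4) (Fin 3) ℂ} {k l : ℂ} {a b : P3}
    (hM : IsGood C M k) (hl : l ≠ 0) (ha : HasParam M a 0 1) (hb : HasParam M b l 1)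
    (v : Fin 4 → ℂ) :
    v ∈ C.tangent a ∧ v ∈ C.tangent b ↔ ∃ c : ℂ, v = c • (M *ᵥ ![0, l, 2]) := by
  constructor
  · rintro ⟨h1, h2⟩
    obtain ⟨x, rfl⟩ := (hM.range v).1 h1.1
    have e1 := (hM.mem_tangent_iff ha x).1 h1
    have e2 := (hM.mem_tangent_iff hb x).1 h2
    have e1' : x 0 = 0 := by linear_combination e1
    have e2' : l * x 2 = 2 * x 1 := by
      apply mul_left_cancel₀ hl
      linear_combination e2 - e1'
    refine ⟨x 2 / 2, ?_⟩
    rw [← Matrix.mulVec_smul]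
    congr 1
    funext i
    fin_cases i
    · simp [e1']
    · simp
      linear_combination -((1 : ℂ) / 2) * e2'
    · simp
  · rintro ⟨c, rfl⟩
    refine ⟨Submodule.smul_mem _ _ ((hM.mem_tangent_iff ha _).2 ?_),
      Submodule.smul_mem _ _ ((hM.mem_tangent_iff hb _).2 ?_)⟩
    · simp
    · simp
      ring

theorem IsGood.mem_tangents_iff' {C : Conic ℂ} {M : Matrix (Fin 4) (Fin 3) ℂ} {k : ℂ} {a b : P3}
    (hM : IsGood C M k) (ha : HasParam M a 1 1) (hb : HasParam M b 1 0) (v : Fin 4 → ℂ) :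
    v ∈ C.tangent a ∧ v ∈ C.tangent b ↔ ∃ c : ℂ, v = c • (M *ᵥ ![2, 1, 0]) := by
  constructor
  · rintro ⟨h1, h2⟩
    obtain ⟨x, rfl⟩ := (hM.range v).1 h1.1
    have e1 := (hM.mem_tangent_iff ha x).1 h1
    have e2 := (hM.mem_tangent_iff hb x).1 h2
    have e2' : x 2 = 0 := by linear_combination e2
    refine ⟨x 1, ?_⟩
    rw [← Matrix.mulVec_smul]
    congr 1
    funext i
    fin_cases i
    · simp
      linear_combination e1 - e2'
    · simp
    · simp [e2']
  · rintro ⟨c, rfl⟩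
    refine ⟨Submodule.smul_mem _ _ ((hM.mem_tangent_iff ha _).2 ?_),
      Submodule.smul_mem _ _ ((hM.mem_tangent_iff hb _).2 ?_)⟩
    · simp
    · simp

theorem edgeCurveBranchedOver_of_poles {C₁ C₂ : Conic ℂ} {a b c d p q : P3}
    (hS : {a, b, c, d} ⊆ C₁.points) (hab : a ≠ b) (hac : a ≠ c)
    (had : a ≠ d) (hbc : b ≠ c) (hbd : b ≠ d) (hcd : c ≠ d)
    (hpa : p.rep ∈ C₁.tangent a) (hpb : p.rep ∈ C₁.tangent b) (hqc : q.rep ∈ C₁.tangent c)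
    (hqd : q.rep ∈ C₁.tangent d) (hp : p ∈ C₂.points) (hq : q ∈ C₂.points)
    (hspan : C₁.span ≠ C₂.span) : EdgeCurveBranchedOver C₁ C₂ {a, b, c, d} := by
  -- The points are taken in the order `a`, `c`, `b`, `d`, so that the pair `{a, b}` gets the
  -- parameters `0`, `l` and the pair `{c, d}` gets `1`, `∞`.
  obtain ⟨M₁, k₁, l, h₁, h0, h1, ha, hc, hb, hd⟩ := exists_isGood_of_points C₁ (a := a) (b := c)
    (c := b) (d := d) (hS (by simp)) (hS (by simp)) (hS (by simp)) (hS (by simp)) hac hab had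
    hbc.symm hcd hbd
  obtain ⟨x, hx⟩ := (h₁.mem_tangents_iff h0 ha hb _).1 ⟨hpa, hpb⟩
  obtain ⟨y, hy⟩ := (h₁.mem_tangents_iff' hc hd _).1 ⟨hqc, hqd⟩
  have hx0 : x ≠ 0 := by
    rintro rfl
    exact p.rep_nonzero (by rw [hx, zero_smul])
  have hy0 : y ≠ 0 := by
    rintro rfl
    exact q.rep_nonzero (by rw [hy, zero_smul])
  obtain ⟨p1, p2⟩ := hp
  obtain ⟨q1, q2⟩ := hq
  change C₂.polar p.rep p.rep = 0 at p2
  change C₂.polar q.rep q.rep = 0 at q2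
  rw [hx] at p1 p2
  rw [hy] at q1 q2
  rw [dotProduct_smul, smul_eq_mul, mul_eq_zero, or_iff_right hx0] at p1
  rw [dotProduct_smul, smul_eq_mul, mul_eq_zero, or_iff_right hy0] at q1
  rw [C₂.polar_smul_left, C₂.polar_smul_right, mul_eq_zero, or_iff_right hx0, mul_eq_zero,
    or_iff_right hx0] at p2
  rw [C₂.polar_smul_left, C₂.polar_smul_right, mul_eq_zero, or_iff_right hy0, mul_eq_zero,
    or_iff_right hy0] at q2
  obtain ⟨M₂, k₂, h⟩ := config_of_mem h₁ h0 h1 hspan p1 q1 p2 q2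
  rw [Set.insert_comm b c {d}]
  exact h.edgeCurveBranchedOver ha hc hb hd

theorem exists_poles (C : Conic ℂ) {a b c d : P3}
    (hS : {a, b, c, d} ⊆ C.points) (hab : a ≠ b) (hac : a ≠ c)
    (had : a ≠ d) (hbc : b ≠ c) (hbd : b ≠ d) (hcd : c ≠ d) :
    ∃ p q : P3, p ≠ q ∧ (∀ v, v ∈ C.tangent a ∧ v ∈ C.tangent b ↔ v ∈ p.submodule) ∧
      (∀ v, v ∈ C.tangent c ∧ v ∈ C.tangent d ↔ v ∈ q.submodule) := by
  obtain ⟨M, k, l, hM, h0, h1, ha, hc, hb, hd⟩ := exists_isGood_of_points C (a := a) (b := c)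
    (c := b) (d := d) (hS (by simp)) (hS (by simp)) (hS (by simp)) (hS (by simp)) hac hab had
    hbc.symm hcd hbd
  have hP : M *ᵥ ![0, l, 2] ≠ 0 := hM.mulVec_ne_zero fun h => by simpa using congrFun h 2
  have hQ : M *ᵥ ![2, 1, 0] ≠ 0 := hM.mulVec_ne_zero fun h => by simpa using congrFun h 1
  refine ⟨Projectivization.mk ℂ _ hP, Projectivization.mk ℂ _ hQ, ?_, fun v => ?_, fun v => ?_⟩
  · intro h
    obtain ⟨x, hx⟩ := (Projectivization.mk_eq_mk_iff' _ _ _ _ _).1 h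
    rw [← Matrix.mulVec_smul] at hx
    have := congrFun (hM.inj hx) 2
    simp at this
  · rw [hM.mem_tangents_iff h0 ha hb, Projectivization.submodule_mk, Submodule.mem_span_singleton]
    simp only [eq_comm]
  · rw [hM.mem_tangents_iff' hc hd, Projectivization.submodule_mk, Submodule.mem_span_singleton]
    simp only [eq_comm]

theorem poles_ne (C : Conic ℂ) {a b c d p q : P3}
    (hS : {a, b, c, d} ⊆ C.points) (hab : a ≠ b) (hac : a ≠ c)
    (had : a ≠ d) (hbc : b ≠ c) (hbd : b ≠ d) (hcd : c ≠ d)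
    (hpa : p.rep ∈ C.tangent a) (hpb : p.rep ∈ C.tangent b) (hqc : q.rep ∈ C.tangent c)
    (hqd : q.rep ∈ C.tangent d) : p ≠ q := by
  obtain ⟨p', q', hne, hp, hq⟩ := exists_poles C hS hab hac had hbc hbd hcd
  rintro rfl
  apply hne
  rw [← eq_of_mem_submodule p.rep_nonzero (rep_mem_submodule p) ((hp _).1 ⟨hpa, hpb⟩),
    ← eq_of_mem_submodule p.rep_nonzero (rep_mem_submodule p) ((hq _).1 ⟨hqc, hqd⟩)]

/-! ### Complex conjugation -/

theorem star_mem_submodule_conj {p : P3} {v : Fin 4 → ℂ} (h : v ∈ p.submodule) :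
    star v ∈ (conj p).submodule := by
  rw [Projectivization.submodule_eq, Submodule.mem_span_singleton] at h
  obtain ⟨a, rfl⟩ := h
  rw [star_smul]
  exact Submodule.smul_mem _ _ (mem_submodule_mk _)

theorem conj_conj (p : P3) : conj (conj p) = p := by
  have h := star_mem_submodule_conj (star_mem_submodule_conj (rep_mem_submodule p))
  rw [star_star] at h
  exact (eq_of_mem_submodule p.rep_nonzero (rep_mem_submodule p) h).symm

theorem exists_rep_conj (p : P3) : ∃ c : ℂ, c ≠ 0 ∧ (conj p).rep = c • star p.rep :=
  exists_rep_eq_smul (star_ne_zero.2 p.rep_nonzero) (star_mem_submodule_conj (rep_mem_submodule p))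

theorem mulVec_star_of_real {m n : ℕ} (A : Matrix (Fin m) (Fin n) ℝ) (x : Fin n → ℂ) :
    (A.map Complex.ofReal) *ᵥ star x = star ((A.map Complex.ofReal) *ᵥ x) := by
  funext i
  simp [Matrix.mulVec, dotProduct]

theorem complexify_plane_star (C : Conic ℝ) (x : Fin 4 → ℂ) :
    C.complexify.plane ⬝ᵥ star x = star (C.complexify.plane ⬝ᵥ x) := by
  simp [Conic.complexify, dotProduct]

theorem complexify_polar_star (C : Conic ℝ) (x y : Fin 4 → ℂ) :
    C.complexify.polar (star x) (star y) = star (C.complexify.polar x y) := by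
  unfold Conic.polar
  change star x ⬝ᵥ (C.quad.map Complex.ofReal *ᵥ star y) = _
  rw [mulVec_star_of_real, ← Matrix.star_dotProduct_star, dotProduct_comm]
  rfl

theorem star_mem_tangent_conj (C : Conic ℝ) {a : P3} {v : Fin 4 → ℂ}
    (h : v ∈ C.complexify.tangent a) : star v ∈ C.complexify.tangent (conj a) := by
  obtain ⟨h1, h2⟩ := h
  obtain ⟨c, -, hc⟩ := exists_rep_conj a
  refine ⟨?_, ?_⟩
  · rw [complexify_plane_star, h1, star_zero]
  · change C.complexify.polar _ _ = 0
    change C.complexify.polar _ _ = 0 at h2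
    rw [hc, Conic.polar_smul_left, complexify_polar_star, h2, star_zero, mul_zero]

/-- Conjugation fixes or exchanges the tangents at `a` and `b`, so it fixes their intersection. -/
theorem conj_pole_eq (C : Conic ℝ) {a b p : P3}
    (hp : ∀ v, v ∈ C.complexify.tangent a ∧ v ∈ C.complexify.tangent b ↔ v ∈ p.submodule)
    (hab : conj '' {a, b} = {a, b}) : conj p = p := by
  have h := (hp p.rep).2 (rep_mem_submodule p)
  have h1 := star_mem_tangent_conj C h.1
  have h2 := star_mem_tangent_conj C h.2
  rw [Set.image_pair] at hab
  have hmem : star p.rep ∈ p.submodule := by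
    rw [← hp]
    rcases Set.pair_eq_pair_iff.1 hab with ⟨e1, e2⟩ | ⟨e1, e2⟩
    · rw [e1] at h1
      rw [e2] at h2
      exact ⟨h1, h2⟩
    · rw [e1] at h1
      rw [e2] at h2
      exact ⟨h2, h1⟩
  exact eq_of_mem_submodule (star_ne_zero.2 p.rep_nonzero)
    (star_mem_submodule_conj (rep_mem_submodule p)) hmem

/-- If some `x` is moved, `{x, f x}` is a stable pair; otherwise every pair is stable. The
complement of a stable pair is again stable. -/
theorem exists_four_of_ncard {α : Type*} {S : Set α} (h : S.ncard = 4) {f : α → α}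
    (hf : Function.Involutive f) (hS : f '' S = S) :
    ∃ a b c d, S = {a, b, c, d} ∧ a ≠ b ∧ a ≠ c ∧ a ≠ d ∧ b ≠ c ∧ b ≠ d ∧ c ≠ d ∧
      f '' {a, b} = {a, b} ∧ f '' {c, d} = {c, d} := by
  have hfin : S.Finite := Set.finite_of_ncard_ne_zero (by omega)
  obtain ⟨a, b, hab, habS, hfab⟩ : ∃ a b, a ≠ b ∧ {a, b} ⊆ S ∧ f '' {a, b} = {a, b} := by
    by_cases hx : ∃ x ∈ S, f x ≠ x
    · obtain ⟨x, hx, hne⟩ := hx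
      refine ⟨x, f x, hne.symm, ?_, ?_⟩
      · rintro y (rfl | rfl)
        · exact hx
        · rw [← hS]
          exact ⟨x, hx, rfl⟩
      · rw [Set.image_pair, hf x, Set.pair_comm]
    · push Not at hx
      obtain ⟨a, ha, b, hb, hab⟩ := (Set.one_lt_ncard hfin).1 (by omega : 1 < S.ncard)
      refine ⟨a, b, hab, ?_, ?_⟩
      · rintro y (rfl | rfl) <;> assumption
      · rw [Set.image_pair, hx a ha, hx b hb]
  have hcard : (S \ {a, b}).ncard = 2 := by
    rw [Set.ncard_sdiff habS, h, Set.ncard_pair hab]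
  obtain ⟨c, d, hcd, he⟩ := Set.ncard_eq_two.1 hcard
  have hc : c ∈ S \ {a, b} := by rw [he]; simp
  have hd : d ∈ S \ {a, b} := by rw [he]; simp
  have hc' := hc.2
  have hd' := hd.2
  simp only [Set.mem_insert_iff, Set.mem_singleton_iff, not_or] at hc' hd'
  refine ⟨a, b, c, d, ?_, hab, Ne.symm hc'.1, Ne.symm hd'.1, Ne.symm hc'.2, Ne.symm hd'.2, hcd,
    hfab, ?_⟩
  · rw [← Set.union_sdiff_cancel habS, he]
    ext x
    simp only [Set.mem_union, Set.mem_insert_iff, Set.mem_singleton_iff]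
    tauto
  · rw [← he, Set.image_sdiff hf.injective, hS, hfab]

theorem ne_of_ncard_eq_four {α : Type*} {a b c d : α} (h : ({a, b, c, d} : Set α).ncard = 4) :
    a ≠ b ∧ a ≠ c ∧ a ≠ d ∧ b ≠ c ∧ b ≠ d ∧ c ≠ d := by
  classical
  have h3 : ∀ x y z : α, ({x, y, z} : Set α).ncard ≤ 3 := by
    intro x y z
    have := Set.ncard_insert_le x {y, z}
    have := Set.ncard_insert_le y {z}
    rw [Set.ncard_singleton] at this
    omega
  refine ⟨?_, ?_, ?_, ?_, ?_, ?_⟩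
  all_goals
    rintro rfl
  · have := h3 a c d
    rw [Set.insert_idem] at h
    omega
  · have := h3 b a d
    rw [Set.insert_comm b, Set.insert_idem, Set.insert_comm] at h
    omega
  · have := h3 b c a
    rw [Set.pair_comm c, Set.insert_comm b, Set.insert_idem, Set.insert_comm, Set.pair_comm a] at h
    omega
  · have := h3 a b d
    rw [Set.insert_idem] at h
    omega
  · have := h3 a b c
    rw [Set.pair_comm c, Set.insert_idem] at h
    omega
  · have := h3 a b c
    rw [Set.pair_eq_singleton] at h
    omega

/-- The hyperplanes with coefficients `(1, k, k², k³)` suffice: a nonzero vector lies on finitely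
many of them, as its incidence condition is a nonzero polynomial in `k`. -/
theorem exists_chart_real {x y : Fin 4 → ℂ} (hx : x ≠ 0) (hy : y ≠ 0) :
    ∃ g : GL (Fin 4) ℝ, (((g : Matrix (Fin 4) (Fin 4) ℝ).map Complex.ofReal) *ᵥ x) 0 ≠ 0 ∧
      (((g : Matrix (Fin 4) (Fin 4) ℝ).map Complex.ofReal) *ᵥ y) 0 ≠ 0 := by
  let P : (Fin 4 → ℂ) → Polynomial ℂ := fun x => Polynomial.C (x 0) +
    Polynomial.C (x 1) * Polynomial.X + Polynomial.C (x 2) * Polynomial.X ^ 2 +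
    Polynomial.C (x 3) * Polynomial.X ^ 3
  have hP : ∀ x, x ≠ 0 → P x ≠ 0 := by
    intro x hx h
    apply hx
    have hc : ∀ n, (P x).coeff n = 0 := fun n => by rw [h, Polynomial.coeff_zero]
    have h0 := hc 0
    have h1 := hc 1
    have h2 := hc 2
    have h3 := hc 3
    simp [P, Polynomial.coeff_X, Polynomial.coeff_C, Polynomial.coeff_X_pow] at h0 h1 h2 h3
    funext i
    fin_cases i <;> assumption
  obtain ⟨k, hk⟩ : ∃ k : ℕ, (P x * P y).eval (k : ℂ) ≠ 0 := by
    by_contra! h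
    refine mul_ne_zero (hP x hx) (hP y hy) (Polynomial.eq_zero_of_infinite_isRoot _ ?_)
    exact (Set.infinite_range_of_injective (Nat.cast_injective (R := ℂ))).mono (by
      rintro _ ⟨k, rfl⟩
      exact h k)
  rw [Polynomial.eval_mul] at hk
  have hdet : (!![1, (k : ℝ), (k : ℝ) ^ 2, (k : ℝ) ^ 3; 0, 1, 0, 0; 0, 0, 1, 0;
      0, 0, 0, 1]).det ≠ 0 := by
    simp [Matrix.det_succ_row_zero, Fin.sum_univ_succ]
  have hval : ∀ x, (((!![1, (k : ℝ), (k : ℝ) ^ 2, (k : ℝ) ^ 3; 0, 1, 0, 0; 0, 0, 1, 0;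
      0, 0, 0, 1]).map Complex.ofReal) *ᵥ x) 0 = (P x).eval (k : ℂ) := by
    intro x
    simp [P, Matrix.mulVec, dotProduct, Fin.sum_univ_four]
    ring
  refine ⟨Matrix.GeneralLinearGroup.mkOfDetNeZero _ hdet, ?_, ?_⟩
  · change (((!![1, (k : ℝ), (k : ℝ) ^ 2, (k : ℝ) ^ 3; 0, 1, 0, 0; 0, 0, 1, 0;
      0, 0, 0, 1]).map Complex.ofReal) *ᵥ x) 0 ≠ 0
    rw [hval]
    exact left_ne_zero_of_mul hk
  · change (((!![1, (k : ℝ), (k : ℝ) ^ 2, (k : ℝ) ^ 3; 0, 1, 0, 0; 0, 0, 1, 0;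
      0, 0, 0, 1]).map Complex.ofReal) *ᵥ y) 0 ≠ 0
    rw [hval]
    exact right_ne_zero_of_mul hk

theorem exists_real_pairOfPoles (C : Conic ℝ) (S : Set P3) (hS : S ⊆ C.complexify.points)
    (hcard : S.ncard = 4) (hreal : IsRealSet S) :
    ∃ (p q : P3) (g : GL (Fin 4) ℝ), IsPairOfPoles C.complexify S p q ∧ IsRealSet {p, q} ∧
      coords g p 0 ≠ 0 ∧ coords g q 0 ≠ 0 := by
  obtain ⟨a, b, c, d, rfl, hab, hac, had, hbc, hbd, hcd, h1, h2⟩ :=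
    exists_four_of_ncard hcard conj_conj hreal
  obtain ⟨p, q, -, hp, hq⟩ := exists_poles C.complexify hS hab hac had hbc hbd hcd
  obtain ⟨g, hgp, hgq⟩ := exists_chart_real p.rep_nonzero q.rep_nonzero
  have hp' := (hp _).2 (rep_mem_submodule p)
  have hq' := (hq _).2 (rep_mem_submodule q)
  refine ⟨p, q, g, ⟨a, b, c, d, rfl, hp'.1, hp'.2, hq'.1, hq'.2⟩, ?_, hgp, hgq⟩
  rw [IsRealSet, Set.image_pair, conj_pole_eq C hp h1, conj_pole_eq C hq h2]

/-! ### Circles -/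

namespace Conic

variable {K : Type} [Field K]

/-- The preimage of a conic under an invertible linear map. -/
def comap (C : Conic K) (A B : Matrix (Fin 4) (Fin 4) K) (hAB : A * B = 1) : Conic K where
  plane := C.plane ᵥ* A
  quad := Aᵀ * C.quad * A
  plane_ne_zero := by
    intro h
    apply C.plane_ne_zero
    have : (C.plane ᵥ* A) ᵥ* B = 0 := by rw [h, Matrix.zero_vecMul]
    rwa [Matrix.vecMul_vecMul, hAB, Matrix.vecMul_one] at this
  isSymm := by
    unfold Matrix.IsSymm
    rw [Matrix.transpose_mul, Matrix.transpose_mul, Matrix.transpose_transpose, C.isSymm.eq,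
      Matrix.mul_assoc]
  smooth := by
    intro x hx h
    have hA : A *ᵥ x = 0 := by
      refine C.smooth _ ?_ fun y hy => ?_
      · rwa [Matrix.dotProduct_mulVec]
      · have := h (B *ᵥ y) (by
          rw [← Matrix.dotProduct_mulVec, Matrix.mulVec_mulVec, hAB, Matrix.one_mulVec, hy])
        rwa [← Matrix.mulVec_mulVec, ← Matrix.mulVec_mulVec, Matrix.mulVec_mulVec _ A B, hAB,
          Matrix.one_mulVec, Matrix.dotProduct_mulVec, Matrix.vecMul_transpose] at this
    have h1 : B *ᵥ (A *ᵥ x) = 0 := by rw [hA, Matrix.mulVec_zero]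
    rwa [Matrix.mulVec_mulVec, mul_eq_one_comm.1 hAB, Matrix.one_mulVec] at h1

theorem comap_plane (C : Conic K) (A B : Matrix (Fin 4) (Fin 4) K) (hAB : A * B = 1)
    (x : Fin 4 → K) : (C.comap A B hAB).plane ⬝ᵥ x = C.plane ⬝ᵥ (A *ᵥ x) := by
  rw [Matrix.dotProduct_mulVec]
  rfl

theorem comap_polar (C : Conic K) (A B : Matrix (Fin 4) (Fin 4) K) (hAB : A * B = 1)
    (x y : Fin 4 → K) : (C.comap A B hAB).polar x y = C.polar (A *ᵥ x) (A *ᵥ y) := by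
  change x ⬝ᵥ ((Aᵀ * C.quad * A) *ᵥ y) = _
  rw [← Matrix.mulVec_mulVec, ← Matrix.mulVec_mulVec, Matrix.dotProduct_mulVec,
    Matrix.vecMul_transpose]
  rfl

end Conic

/-- The complexified circle with center `0`, radius `r` and normal vector `n`. -/
def centeredCircle (n : Fin 3 → ℝ) (r : ℝ) (hn : n ≠ 0) (hr : 0 < r) : Conic ℂ where
  plane := ![0, n 0, n 1, n 2]
  quad := Matrix.diagonal ![-(r : ℂ) ^ 2, 1, 1, 1]
  plane_ne_zero := by
    intro h
    apply hn
    have h1 := congrFun h 1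
    have h2 := congrFun h 2
    have h3 := congrFun h 3
    simp at h1 h2 h3
    funext i
    fin_cases i <;> assumption
  isSymm := Matrix.isSymm_diagonal _
  smooth := by
    intro x hx h
    have h0 := h ![1, 0, 0, 0] (by simp [dotProduct, Fin.sum_univ_succ])
    -- Since `n` is real, the conjugate of `x` with its coordinate `0` removed is again in the
    -- plane. Pairing it with `x` gives a sum of squared absolute values.
    have h1 := h ![0, star (x 1), star (x 2), star (x 3)] (by
      have := congrArg star hx
      simpa [dotProduct, Fin.sum_univ_four] using this)
    simp [dotProduct, Matrix.mulVec_diagonal, Fin.sum_univ_four, hr.ne'] at h0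
    simp [dotProduct, Matrix.mulVec_diagonal, Fin.sum_univ_four, Complex.mul_conj] at h1
    have h2 : Complex.normSq (x 1) + Complex.normSq (x 2) + Complex.normSq (x 3) = 0 := by
      exact_mod_cast h1
    have g1 := Complex.normSq_nonneg (x 1)
    have g2 := Complex.normSq_nonneg (x 2)
    have g3 := Complex.normSq_nonneg (x 3)
    have e1 : x 1 = 0 := Complex.normSq_eq_zero.1 (by linarith)
    have e2 : x 2 = 0 := Complex.normSq_eq_zero.1 (by linarith)
    have e3 : x 3 = 0 := Complex.normSq_eq_zero.1 (by linarith)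
    funext i
    fin_cases i <;> assumption

theorem map_ofReal_mul_inv (g : GL (Fin 4) ℝ) :
    (g : Matrix (Fin 4) (Fin 4) ℝ).map Complex.ofReal *
      ((g⁻¹ : GL (Fin 4) ℝ) : Matrix (Fin 4) (Fin 4) ℝ).map Complex.ofReal = 1 := by
  have h : (g : Matrix (Fin 4) (Fin 4) ℝ) *
      ((g⁻¹ : GL (Fin 4) ℝ) : Matrix (Fin 4) (Fin 4) ℝ) = 1 :=
    Units.mul_inv g
  have := congrArg (fun A : Matrix (Fin 4) (Fin 4) ℝ => A.map Complex.ofRealHom) h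
  simp only [Matrix.map_mul] at this
  rw [Matrix.map_one _ (map_zero _) (map_one _)] at this
  exact this

/-- The circle is the pullback of a centered one under `g` followed by the translation that moves
`c` to the origin. -/
theorem exists_circle (g : GL (Fin 4) ℝ) (n c : Fin 3 → ℝ) (r : ℝ) (hn : n ≠ 0) (hr : 0 < r) :
    ∃ C : Conic ℂ, IsCircle g C ∧
      (∀ x y, ((g : Matrix (Fin 4) (Fin 4) ℝ).map Complex.ofReal) *ᵥ x = y →
        C.plane ⬝ᵥ x = ∑ i, (n i : ℂ) * (y i.succ - c i * y 0)) ∧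
      ∀ p : P3, p ∈ C.points ↔ (∑ i, (n i : ℂ) * (coords g p i.succ - c i * coords g p 0) = 0 ∧
        ∑ i, (coords g p i.succ - c i * coords g p 0) ^ 2 = (r : ℂ) ^ 2 * coords g p 0 ^ 2) := by
  let c' : Fin 4 → ℂ := Fin.cons 0 fun i => (c i : ℂ)
  let e : Fin 4 → ℂ := Pi.single 0 1
  -- The translations by `-c` and `c` are `1 - N` and `1 + N` with `N² = 0`, hence mutually inverse.
  have hV : Matrix.vecMulVec c' e * Matrix.vecMulVec c' e = 0 := by
    rw [Matrix.vecMulVec_mul_vecMulVec]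
    simp [e, c']
  let G := (g : Matrix (Fin 4) (Fin 4) ℝ).map Complex.ofReal
  let G' := ((g⁻¹ : GL (Fin 4) ℝ) : Matrix (Fin 4) (Fin 4) ℝ).map Complex.ofReal
  have hG : G * G' = 1 := map_ofReal_mul_inv g
  have hAB : ((1 - Matrix.vecMulVec c' e) * G) * (G' * (1 + Matrix.vecMulVec c' e)) = 1 := by
    rw [Matrix.mul_assoc, ← Matrix.mul_assoc G, hG, Matrix.one_mul, Matrix.sub_mul, Matrix.mul_add,
      Matrix.one_mul, Matrix.mul_add, hV]
    simp
  have hA0 : ∀ x, (((1 - Matrix.vecMulVec c' e) * G) *ᵥ x) 0 = (G *ᵥ x) 0 := by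
    intro x
    rw [← Matrix.mulVec_mulVec, Matrix.sub_mulVec, Matrix.vecMulVec_mulVec]
    simp [c']
  have hAi : ∀ x (i : Fin 3), (((1 - Matrix.vecMulVec c' e) * G) *ᵥ x) i.succ =
      (G *ᵥ x) i.succ - c i * (G *ᵥ x) 0 := by
    intro x i
    rw [← Matrix.mulVec_mulVec, Matrix.sub_mulVec, Matrix.vecMulVec_mulVec]
    simp [c', e]
    ring
  obtain ⟨C, hC⟩ : ∃ C, C = (centeredCircle n r hn hr).comap _ _ hAB := ⟨_, rfl⟩
  have hplane : ∀ x, C.plane ⬝ᵥ x =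
      ∑ i : Fin 3, (n i : ℂ) * ((G *ᵥ x) i.succ - c i * (G *ᵥ x) 0) := by
    intro x
    rw [hC, Conic.comap_plane]
    simp only [← hAi]
    simp [centeredCircle, dotProduct, Fin.sum_univ_succ]
  have hquad : ∀ x, C.polar x x =
      ∑ i : Fin 3, ((G *ᵥ x) i.succ - c i * (G *ᵥ x) 0) ^ 2 - (r : ℂ) ^ 2 * (G *ᵥ x) 0 ^ 2 := by
    intro x
    rw [hC, Conic.comap_polar]
    simp only [← hAi]
    rw [← hA0]
    simp only [centeredCircle, Conic.polar, dotProduct, Matrix.mulVec_diagonal]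
    simp [Fin.sum_univ_succ]
    ring
  have hpts : ∀ p : P3, p ∈ C.points ↔
      (∑ i, (n i : ℂ) * (coords g p i.succ - c i * coords g p 0) = 0 ∧
        ∑ i, (coords g p i.succ - c i * coords g p 0) ^ 2 = (r : ℂ) ^ 2 * coords g p 0 ^ 2) := by
    intro p
    change C.plane ⬝ᵥ p.rep = 0 ∧ C.polar p.rep p.rep = 0 ↔ _
    rw [hplane, hquad, sub_eq_zero]
    rfl
  refine ⟨C, ⟨n, c, r, hn, hr, hpts⟩, ?_, hpts⟩
  rintro x _ rfl
  exact hplane x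

theorem coords_conj (g : GL (Fin 4) ℝ) (p : P3) :
    ∃ c : ℂ, c ≠ 0 ∧ ∀ i, coords g (conj p) i = c * star (coords g p i) := by
  obtain ⟨c, hc, hc'⟩ := exists_rep_conj p
  refine ⟨c, hc, fun i => ?_⟩
  unfold coords
  rw [hc', Matrix.mulVec_smul, mulVec_star_of_real]
  rfl

theorem eq_of_coords {g : GL (Fin 4) ℝ} {p q : P3} {a b : ℂ} (ha : a ≠ 0)
    (h : ∀ i, a * coords g p i = b * coords g q i) : p = q := by
  have hg := mul_eq_one_comm.1 (map_ofReal_mul_inv g)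
  have h1 : ((g : Matrix (Fin 4) (Fin 4) ℝ).map Complex.ofReal) *ᵥ (a • p.rep) =
      ((g : Matrix (Fin 4) (Fin 4) ℝ).map Complex.ofReal) *ᵥ (b • q.rep) := by
    rw [Matrix.mulVec_smul, Matrix.mulVec_smul]
    funext i
    exact h i
  have h2 := congrArg
    (((g⁻¹ : GL (Fin 4) ℝ) : Matrix (Fin 4) (Fin 4) ℝ).map Complex.ofReal *ᵥ ·) h1
  simp only [Matrix.mulVec_mulVec, hg, Matrix.one_mulVec] at h2
  refine eq_of_mem_submodule (smul_ne_zero ha p.rep_nonzero)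
    (Submodule.smul_mem _ _ (rep_mem_submodule p)) ?_
  rw [h2]
  exact Submodule.smul_mem _ _ (rep_mem_submodule q)

/-- Two points that form a real set are `u ± ε v` with real `u`, `v` and `ε ∈ {1, i}`. -/
theorem exists_real_midpoint {g : GL (Fin 4) ℝ} {p q : P3} (hpq : p ≠ q) (hreal : IsRealSet {p, q})
    (hp : coords g p 0 ≠ 0) (hq : coords g q 0 ≠ 0) :
    ∃ (u v : Fin 3 → ℝ) (ε : ℂ) (e : ℝ), ε ≠ 0 ∧ ε ^ 2 = e ∧ -1 ≤ e ∧ v ≠ 0 ∧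
      (∀ i, coords g p i.succ = (u i + ε * v i) * coords g p 0) ∧
      ∀ i, coords g q i.succ = (u i - ε * v i) * coords g q 0 := by
  obtain ⟨y, hy⟩ : ∃ y : Fin 3 → ℂ, ∀ i, coords g p i.succ = y i * coords g p 0 :=
    ⟨fun i => coords g p i.succ / coords g p 0, fun i => by field_simp⟩
  obtain ⟨z, hz⟩ : ∃ z : Fin 3 → ℂ, ∀ i, coords g q i.succ = z i * coords g q 0 :=
    ⟨fun i => coords g q i.succ / coords g q 0, fun i => by field_simp⟩
  have hyz : y ≠ z := by
    rintro rfl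
    apply hpq
    refine eq_of_coords (g := g) (b := coords g p 0) hq fun i => ?_
    refine Fin.cases ?_ (fun j => ?_) i
    · ring
    · rw [hy, hz]
      ring
  have hconj : ∀ {p q : P3} {y z : Fin 3 → ℂ}, coords g q 0 ≠ 0 →
      (∀ i, coords g p i.succ = y i * coords g p 0) →
      (∀ i, coords g q i.succ = z i * coords g q 0) → conj p = q → ∀ i, z i = star (y i) := by
    rintro p q y z hq hy hz rfl i
    obtain ⟨c, hc, hc'⟩ := coords_conj g p
    apply mul_right_cancel₀ hq
    rw [← hz, hc', hc', hy, star_mul']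
    ring
  rw [IsRealSet, Set.image_pair] at hreal
  -- Either both points are real, and `ε = 1`, or they are conjugate to each other, and `ε = i`.
  rcases Set.pair_eq_pair_iff.1 hreal with ⟨e1, e2⟩ | ⟨e1, e2⟩
  · have hy' : ∀ i, ((y i).re : ℂ) = y i := fun i =>
      Complex.conj_eq_iff_re.1 (hconj hp hy hy e1 i).symm
    have hz' : ∀ i, ((z i).re : ℂ) = z i := fun i =>
      Complex.conj_eq_iff_re.1 (hconj hq hz hz e2 i).symm
    refine ⟨fun i => ((y i).re + (z i).re) / 2, fun i => ((y i).re - (z i).re) / 2, 1, 1,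
      one_ne_zero, by norm_num, by norm_num, ?_, fun i => ?_, fun i => ?_⟩
    · intro h
      apply hyz
      funext i
      have : ((y i).re - (z i).re) / 2 = 0 := congrFun h i
      have h1 : (y i).re = (z i).re := by linarith
      rw [← hy', ← hz', h1]
    · rw [hy]
      push_cast
      rw [hy', hz']
      ring
    · rw [hz]
      push_cast
      rw [hy', hz']
      ring
  · have hz' : ∀ i, z i = star (y i) := hconj hq hy hz e1
    have h1 : ∀ i, ((y i).re : ℂ) + Complex.I * (y i).im = y i := by
      intro i
      rw [mul_comm]
      exact Complex.re_add_im _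
    have h2 : ∀ i, ((y i).re : ℂ) - Complex.I * (y i).im = z i := by
      intro i
      rw [hz']
      apply Complex.ext <;> simp
    refine ⟨fun i => (y i).re, fun i => (y i).im, Complex.I, -1, Complex.I_ne_zero, by simp,
      le_refl _, ?_, fun i => ?_, fun i => ?_⟩
    · intro h
      apply hyz
      funext i
      have : (y i).im = 0 := congrFun h i
      rw [← h1, ← h2, this]
      simp
    · rw [hy, h1]
    · rw [hz, h2]

theorem sum_sq_pos {v : Fin 3 → ℝ} (hv : v ≠ 0) : 0 < v 0 ^ 2 + v 1 ^ 2 + v 2 ^ 2 := by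
  by_contra! h
  apply hv
  have e0 : v 0 ^ 2 = 0 := by nlinarith [sq_nonneg (v 0), sq_nonneg (v 1), sq_nonneg (v 2)]
  have e1 : v 1 ^ 2 = 0 := by nlinarith [sq_nonneg (v 0), sq_nonneg (v 1), sq_nonneg (v 2)]
  have e2 : v 2 ^ 2 = 0 := by nlinarith [sq_nonneg (v 0), sq_nonneg (v 1), sq_nonneg (v 2)]
  funext i
  fin_cases i <;> apply pow_eq_zero_iff two_ne_zero |>.1 <;> assumption

/-- Write `f'` for the normal vector `(f 1, f 2, f 3)` of the plane of `C₁` in the Euclidean space.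
The circle has center `u + t f'` and lies in the plane through it spanned by `v` and `f'`. As `f'`
is orthogonal to `v`, the points `u ± ε v` both have squared distance `t² N + e V` from the center,
where `N = |f'|²` and `V = |v|²`. -/
theorem exists_circle_through (C₁ : Conic ℝ) {g : GL (Fin 4) ℝ} {p q : P3} (hpq : p ≠ q)
    (hreal : IsRealSet {p, q}) (hp : coords g p 0 ≠ 0) (hq : coords g q 0 ≠ 0)
    (hp₁ : C₁.complexify.plane ⬝ᵥ p.rep = 0) (hq₁ : C₁.complexify.plane ⬝ᵥ q.rep = 0) :
    ∃ C₂ : Conic ℂ, IsCircle g C₂ ∧ p ∈ C₂.points ∧ q ∈ C₂.points ∧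
      C₁.complexify.span ≠ C₂.span := by
  obtain ⟨u, v, ε, e, hε, he, he1, hv, hup, huq⟩ := exists_real_midpoint hpq hreal hp hq
  obtain ⟨f, hf⟩ : ∃ f : Fin 4 → ℝ,
      f = C₁.plane ᵥ* ((g⁻¹ : GL (Fin 4) ℝ) : Matrix (Fin 4) (Fin 4) ℝ) := ⟨_, rfl⟩
  have hfg : f ᵥ* (g : Matrix (Fin 4) (Fin 4) ℝ) = C₁.plane := by
    rw [hf, Matrix.vecMul_vecMul, Units.inv_mul, Matrix.vecMul_one]
  have hplane : ∀ x : Fin 4 → ℂ, C₁.complexify.plane ⬝ᵥ x =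
      (fun i => (f i : ℂ)) ⬝ᵥ (((g : Matrix (Fin 4) (Fin 4) ℝ).map Complex.ofReal) *ᵥ x) := by
    intro x
    rw [Matrix.dotProduct_mulVec]
    congr 1
    funext i
    change ((C₁.plane i : ℝ) : ℂ) = _
    rw [← hfg]
    simp [Matrix.vecMul, dotProduct]
  have hcoords : ∀ (p : P3) (y : Fin 3 → ℂ), coords g p 0 ≠ 0 →
      (∀ i, coords g p i.succ = y i * coords g p 0) → C₁.complexify.plane ⬝ᵥ p.rep = 0 →
      (f 0 : ℂ) + (f 1 * y 0 + f 2 * y 1 + f 3 * y 2) = 0 := by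
    intro p y hp hy h
    rw [hplane] at h
    change (fun i => (f i : ℂ)) ⬝ᵥ coords g p = 0 at h
    apply mul_right_cancel₀ hp
    have e0 : coords g p 1 = y 0 * coords g p 0 := hy 0
    have e1 : coords g p 2 = y 1 * coords g p 0 := hy 1
    have e2 : coords g p 3 = y 2 * coords g p 0 := hy 2
    simp only [dotProduct, Fin.sum_univ_four, e0, e1, e2] at h
    linear_combination h
  have hfp := hcoords p _ hp hup hp₁
  have hfq := hcoords q _ hq huq hq₁
  have hfu : f 0 + (f 1 * u 0 + f 2 * u 1 + f 3 * u 2) = 0 := by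
    have : (f 0 : ℂ) + (f 1 * u 0 + f 2 * u 1 + f 3 * u 2) = 0 := by
      linear_combination ((1 : ℂ) / 2) * hfp + ((1 : ℂ) / 2) * hfq
    exact_mod_cast this
  have hfv : f 1 * v 0 + f 2 * v 1 + f 3 * v 2 = 0 := by
    have : (f 1 * v 0 + f 2 * v 1 + f 3 * v 2 : ℂ) = 0 := by
      apply mul_left_cancel₀ hε
      linear_combination ((1 : ℂ) / 2) * hfp - ((1 : ℂ) / 2) * hfq
    exact_mod_cast this
  -- The plane of `C₁` is not the plane at infinity, since it contains the finite point `u`.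
  have hN : 0 < f 1 ^ 2 + f 2 ^ 2 + f 3 ^ 2 := by
    refine sum_sq_pos (v := fun i => f i.succ) fun h => C₁.plane_ne_zero ?_
    have e1 : f 1 = 0 := congrFun h 0
    have e2 : f 2 = 0 := congrFun h 1
    have e3 : f 3 = 0 := congrFun h 2
    rw [e1, e2, e3] at hfu
    have e0 : f 0 = 0 := by linarith
    have : f = 0 := by
      funext i
      fin_cases i <;> assumption
    rw [← hfg, this, Matrix.zero_vecMul]
  have hV := sum_sq_pos hv
  obtain ⟨N, hNdef⟩ : ∃ N, N = f 1 ^ 2 + f 2 ^ 2 + f 3 ^ 2 := ⟨_, rfl⟩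
  obtain ⟨V, hVdef⟩ : ∃ V, V = v 0 ^ 2 + v 1 ^ 2 + v 2 ^ 2 := ⟨_, rfl⟩
  rw [← hNdef] at hN
  rw [← hVdef] at hV
  -- With this `t` one has `t² N ≥ t N = N + V > V ≥ -e V`, so the squared radius is positive.
  obtain ⟨t, ht⟩ : ∃ t, t = 1 + V / N := ⟨_, rfl⟩
  have ht1 : 1 ≤ t := by
    rw [ht]
    have := div_pos hV hN
    linarith
  have htN : t * N = N + V := by
    rw [ht]
    field_simp
  have hr2 : 0 < t ^ 2 * N + e * V := by nlinarith
  have hr : 0 < Real.sqrt (t ^ 2 * N + e * V) := Real.sqrt_pos.2 hr2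
  have hrr : (Real.sqrt (t ^ 2 * N + e * V)) ^ 2 = t ^ 2 * N + e * V := Real.sq_sqrt hr2.le
  obtain ⟨r, hrdef⟩ : ∃ r, r = Real.sqrt (t ^ 2 * N + e * V) := ⟨_, rfl⟩
  rw [← hrdef] at hr hrr
  -- The normal is the cross product of `v` and `f'`. It is nonzero by Lagrange's identity, because
  -- both vectors are nonzero and they are orthogonal.
  have hn : (![v 1 * f 3 - v 2 * f 2, v 2 * f 1 - v 0 * f 3, v 0 * f 2 - v 1 * f 1] : Fin 3 → ℝ) ≠
      0 := by
    intro h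
    have e0 := congrFun h 0
    have e1 := congrFun h 1
    have e2 := congrFun h 2
    simp only [Matrix.cons_val_zero, Matrix.cons_val_one, Matrix.cons_val, Pi.zero_apply]
      at e0 e1 e2
    have : V * N = 0 := by
      rw [hVdef, hNdef]
      linear_combination (v 1 * f 3 - v 2 * f 2) * e0 + (v 2 * f 1 - v 0 * f 3) * e1 +
        (v 0 * f 2 - v 1 * f 1) * e2 + (f 1 * v 0 + f 2 * v 1 + f 3 * v 2) * hfv
    exact (mul_pos hV hN).ne' this
  obtain ⟨C₂, hC₂, hpl, hpts⟩ := exists_circle g _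
    ![u 0 + t * f 1, u 1 + t * f 2, u 2 + t * f 3] r hn hr
  have hVc : (V : ℂ) = (v 0 : ℂ) ^ 2 + (v 1 : ℂ) ^ 2 + (v 2 : ℂ) ^ 2 := by exact_mod_cast hVdef
  have hNc : (N : ℂ) = (f 1 : ℂ) ^ 2 + (f 2 : ℂ) ^ 2 + (f 3 : ℂ) ^ 2 := by exact_mod_cast hNdef
  have hrc : (r : ℂ) ^ 2 = t ^ 2 * N + e * V := by exact_mod_cast hrr
  have hfvc : (f 1 * v 0 + f 2 * v 1 + f 3 * v 2 : ℂ) = 0 := by exact_mod_cast hfv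
  have key : ∀ (p : P3) (ε : ℂ), ε ^ 2 = e →
      (∀ i, coords g p i.succ = (u i + ε * v i) * coords g p 0) → p ∈ C₂.points := by
    intro p ε he hup
    rw [hpts]
    simp only [hup, Fin.sum_univ_three, Matrix.cons_val_zero, Matrix.cons_val_one,
      Matrix.cons_val]
    push_cast
    constructor
    · ring
    · rw [hrc, ← he, hVc, hNc]
      linear_combination -2 * ε * t * coords g p 0 ^ 2 * hfvc
  refine ⟨C₂, hC₂, key p ε he hup, key q (-ε) (by rw [neg_sq, he]) ?_, ?_⟩
  · intro i
    rw [huq]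
    ring
  -- The center of the circle separates the planes: the equation of the plane of `C₁` takes the
  -- value `t N ≠ 0` there.
  · intro hspan
    obtain ⟨y, hy⟩ : ∃ y : Fin 4 → ℂ, y = ![1, (u 0 : ℂ) + t * f 1,
        (u 1 : ℂ) + t * f 2, (u 2 : ℂ) + t * f 3] :=
      ⟨_, rfl⟩
    obtain ⟨x, hx⟩ : ∃ x, ((g : Matrix (Fin 4) (Fin 4) ℝ).map Complex.ofReal) *ᵥ x = y :=
      ⟨((g⁻¹ : GL (Fin 4) ℝ) : Matrix (Fin 4) (Fin 4) ℝ).map Complex.ofReal *ᵥ y, by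
        rw [Matrix.mulVec_mulVec, map_ofReal_mul_inv, Matrix.one_mulVec]⟩
    have h2 : x ∈ C₂.span := by
      rw [C₂.mem_span, hpl x y hx, hy]
      simp [Fin.sum_univ_three]
    rw [← hspan, Conic.mem_span, hplane, hx, hy] at h2
    have h3 : t * N = 0 := by
      have : (t * N : ℂ) = 0 := by
        have hfuc : (f 0 + (f 1 * u 0 + f 2 * u 1 + f 3 * u 2) : ℂ) = 0 := by exact_mod_cast hfu
        simp only [dotProduct, Fin.sum_univ_four, Matrix.cons_val_zero, Matrix.cons_val_one,
          Matrix.cons_val] at h2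
        rw [hNc]
        linear_combination h2 - hfuc
      exact_mod_cast this
    linarith

end TwoConics

/-! ### The theorem -/

theorem mainTheorem6 :
    (∀ (C₁ : TwoConics.Conic ℂ) (J : ℂ), ∃ C₂ : TwoConics.Conic ℂ,
      C₁.span ≠ C₂.span ∧ TwoConics.HasJInvariant (TwoConics.edgeCurve C₁ C₂) J) ∧
    (∀ (C₁ : TwoConics.Conic ℂ) (S : Set TwoConics.P3), S ⊆ C₁.points → S.ncard = 4 →
      ∃ C₂ : TwoConics.Conic ℂ, TwoConics.EdgeCurveBranchedOver C₁ C₂ S) ∧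
    (∀ (C₁ : TwoConics.Conic ℝ) (S : Set TwoConics.P3), S ⊆ C₁.complexify.points →
      S.ncard = 4 → TwoConics.IsRealSet S →
      (∃ (p q : TwoConics.P3) (g : GL (Fin 4) ℝ),
        TwoConics.IsPairOfPoles C₁.complexify S p q ∧ TwoConics.IsRealSet {p, q} ∧
        TwoConics.coords g p 0 ≠ 0 ∧ TwoConics.coords g q 0 ≠ 0) ∧
      (∀ (p q : TwoConics.P3) (g : GL (Fin 4) ℝ),
        TwoConics.IsPairOfPoles C₁.complexify S p q → TwoConics.IsRealSet {p, q} →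
        TwoConics.coords g p 0 ≠ 0 → TwoConics.coords g q 0 ≠ 0 →
        ∃ C₂ : TwoConics.Conic ℂ, TwoConics.IsCircle g C₂ ∧
          p ∈ C₂.points ∧ q ∈ C₂.points ∧
          TwoConics.EdgeCurveBranchedOver C₁.complexify C₂ S)) := by
  refine ⟨TwoConics.exists_conic_hasJInvariant, ?_, ?_⟩
  · intro C₁ S hS hcard
    obtain ⟨a, b, c, d, rfl, hab, hac, had, hbc, hbd, hcd, -, -⟩ :=
      -- Over `ℂ` only the enumeration of `S` is needed, so the involution is taken to be the
      -- identity.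
      TwoConics.exists_four_of_ncard hcard (f := id) (fun _ => rfl) (Set.image_id _)
    exact TwoConics.exists_edgeCurveBranchedOver C₁ hS hab hac had hbc hbd hcd
  · intro C₁ S hS hcard hreal
    refine ⟨TwoConics.exists_real_pairOfPoles C₁ S hS hcard hreal, ?_⟩
    rintro p q g ⟨a, b, c, d, rfl, hpa, hpb, hqc, hqd⟩ hpq hp hq
    obtain ⟨hab, hac, had, hbc, hbd, hcd⟩ := TwoConics.ne_of_ncard_eq_four hcard
    obtain ⟨C₂, hC₂, hp₂, hq₂, hspan⟩ := TwoConics.exists_circle_through C₁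
      (TwoConics.poles_ne _ hS hab hac had hbc hbd hcd hpa hpb hqc hqd) hpq hp hq hpa.1 hqc.1
    exact ⟨C₂, hC₂, hp₂, hq₂, TwoConics.edgeCurveBranchedOver_of_poles hS hab hac had hbc hbd hcd
      hpa hpb hqc hqd hp₂ hq₂ hspan⟩
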